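/- Let $\mathbb{K}$ be a field of characteristic zero and let $\mathcal{S} = \bigsqcup_{n \geq 1} \mathcal{S}(n)$ be a positive signature, that is, a set of symbols each having an arity $n \geq 1$. An $\mathcal{S}$-term is either the leaf $\perp$ or a pair $(\mathsf{g}, (\mathfrak{t}_1, \dots, \mathfrak{t}_n))$ with $\mathsf{g} \in \mathcal{S}(n)$ and $\mathcal{S}$-terms $\mathfrak{t}_1, \dots, \mathfrak{t}_n$; it is seen as a planar rooted tree whose internal nodes are decorated by $\mathcal{S}$. A reduced $\mathcal{S}$-forest is a finite (possibly empty) word of $\mathcal{S}$-terms, none of which is $\perp$; let $R$ be the set of reduced $\mathcal{S}$-forests. Let $\mathbf{N}$ be the $\mathbb{K}$-vector space with basis $\{\mathsf{E}_{\mathfrak{f}} : \mathfrak{f} \in R\}$, endowed with the bilinear product that extends the concatenation of forests (the algebra underlying the natural Hopf algebra of the free operad on $\mathcal{S}$). For $\mathfrak{f}, \mathfrak{f}' \in R$, write $\mathfrak{f} \rightharpoonup \mathfrak{f}'$ if $\mathfrak{f}'$ is obtained from $\mathfrak{f}$ by selecting an internal node having an immediate left brother (the brother may be a leaf, and the roots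 of the successive terms of $\mathfrak{f}$ are considered as brothers), detaching the subterm rooted at this node, and grafting it onto the rightmost leaf of its former immediate left brother. When the detached node is not the root of a term, a leaf remains at its place; when it is the root of a term, the forest loses one term. The reflexive and transitive closure $\preccurlyeq$ of $\rightharpoonup$ is a partial order on $R$, the easterly wind order, in which every element has finitely many elements above it and finitely many below it. Let $\mu$ be its Möbius function and set, for $\mathfrak{f} \in R$, $$\mathsf{F}_{\mathfrak{f}} := \sum_{\mathfrak{f}' \in R,\ \mathfrak{f} \preccurlyeq \mathfrak{f}'} \mu(\mathfrak{f}, \mathfrak{f}')\, \mathsf{E}_{\mathfrak{f}'}, \qquad \mathsf{H}_{\mathfrak{f}} := \sum_{\mathfrak{f}' \in R,\ \mathfrak{f}' \preccurlyeq \mathfrak{f}} \mathsf{F}_{\mathfrak{f}'}.$$ A leaf of a term $\mathfrak{t}$ is extremal if, when a new node is grafted onto it, this node is the last internal node of the resulting term in the left to right preorder traversal. For $\mathfrak{f}', \mathfrak{f}'' \in R$, let $\mathfrak{f}' \,/\, \mathfrak{f}''$ ("over") be the concatenation of $\mathfrak{f}'$ and $\mathfrak{f}''$, and let $\mathfrak{f}'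 \,\backslash\, \mathfrak{f}''$ ("under") be obtained from this concatenation as follows: for $k = 1, 2, \dots$, the $k$-th term of $\mathfrak{f}''$ is grafted onto the $k$-th leftmost extremal leaf of the last term $\mathfrak{t}$ of $\mathfrak{f}'$, where the extremal leaves are those of the original term $\mathfrak{t}$, until no term of $\mathfrak{f}''$ or no extremal leaf of $\mathfrak{t}$ remains; the terms of $\mathfrak{f}''$ that have not been grafted stay, in order, at the end of the forest. If $\mathfrak{f}'$ is empty, then $\mathfrak{f}' \,\backslash\, \mathfrak{f}'' := \mathfrak{f}''$. Then, for all $\mathfrak{f}', \mathfrak{f}'' \in R$, $$\mathsf{E}_{\mathfrak{f}'} \cdot \mathsf{E}_{\mathfrak{f}''} = \mathsf{E}_{\mathfrak{f}' / \mathfrak{f}''}, \qquad \mathsf{F}_{\mathfrak{f}'} \cdot \mathsf{F}_{\mathfrak{f}''} = \sum_{\mathfrak{f} \in R,\ \mathfrak{f}' / \mathfrak{f}'' \preccurlyeq \mathfrak{f} \preccurlyeq \mathfrak{f}' \backslash \mathfrak{f}''} \mathsf{F}_{\mathfrak{f}}, \qquad \mathsf{H}_{\mathfrak{f}'} \cdot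 \mathsf{H}_{\mathfrak{f}''} = \mathsf{H}_{\mathfrak{f}' \backslash \mathfrak{f}''}.$$ -/

import Mathlib

universe u v

/-- Terms on a signature `S`, where `S n` is the set of symbols of arity `n`: planar rooted trees
whose internal nodes of arity `n` are decorated by elements of `S n`. -/
inductive Term (S : ℕ → Type u) : Type u
  | leaf : Term S
  | node {n : ℕ} (g : S n) (ts : Fin n → Term S) : Term S

namespace Term

variable {S : ℕ → Type u}

/-- The number of leaves. -/
def arity : Term S → ℕ
  | leaf => 1
  | node _ ts => ∑ i, (ts i).arity

/-- The decorations of the internal nodes, in the left to right preorder traversal. -/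
def preorder : Term S → List (Σ n, S n)
  | leaf => []
  | @node _ n g ts => ⟨n, g⟩ :: (List.ofFn fun i => (ts i).preorder).flatten

/-- Full composition `t[σ 0, σ 1, …]` of the free operad: the root of `σ i` is grafted onto the
`i`-th leaf of `t`, where leaves are numbered from `0`, from left to right.
Only the values `σ i` with `i < t.arity` matter. -/
def comp : Term S → (ℕ → Term S) → Term S
  | leaf, σ => σ 0
  | node g ts, σ =>
    node g fun k => (ts k).comp fun i => σ ((∑ j : Fin k, (ts (j.castLE k.isLt.le)).arity) + i)

/-- Partial composition `t ∘ᵢ s`: grafts `s` onto the `i`-th leaf of `t`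
(leaves are numbered from `0`). -/
def partialComp (t : Term S) (i : ℕ) (s : Term S) : Term S :=
  t.comp fun j => if j = i then s else leaf

/-- Relabelling of the internal nodes. -/
def map {S' : ℕ → Type v} (φ : ∀ n, S n → S' n) : Term S → Term S'
  | leaf => leaf
  | @node _ n g ts => node (φ n g) fun i => (ts i).map φ

/-- Grafts `s` onto the rightmost leaf of `t` (for a positive signature, this leaf is reached by
going from the root to the last child repeatedly). -/
def graftRight : Term S → Term S → Term S
  | leaf, s => s
  | @node _ n g ts, s => node g fun i => if (i : ℕ) + 1 = n then (ts i).graftRight s else ts i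

/-- `t.Step t'`: an internal node of `t`, different from the root, is selected, the subterm
rooted at it is detached (so that a leaf remains at its place) and grafted onto the rightmost leaf
of its former immediate left brother. This brother may be a leaf. -/
inductive Step : Term S → Term S → Prop
  | slide {n : ℕ} (g : S n) (ts : Fin n → Term S) (i j : Fin n) (hij : (i : ℕ) + 1 = j)
      (hj : ts j ≠ leaf) :
      Step (node g ts)
        (node g (Function.update (Function.update ts i ((ts i).graftRight (ts j))) j leaf))
  | child {n : ℕ} (g : S n) (ts : Fin n → Term S) (i : Fin n) (t' : Term S) (h : Step (ts i) t') :
      Step (node g ts) (node g (Function.update ts i t'))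

end Term

/-- The signature `S ⊔ {𝔡}` where `𝔡 = WithConst.const` is a new constant of arity `0`. -/
inductive WithConst (S : ℕ → Type u) : ℕ → Type u
  | base {n : ℕ} (g : S n) : WithConst S n
  | const : WithConst S 0

namespace Term

variable {S : ℕ → Type u}

/-- The `i`-th leaf of `t` (numbered from `0`) is extremal if the node decorated by `𝔡` in
`t ∘ᵢ 𝔡` is the last internal node in preorder. -/
def IsExtremal (t : Term S) (i : ℕ) : Prop :=
  i < t.arity ∧
    ((t.map fun _ g => WithConst.base g).partialComp i
      (node WithConst.const Fin.elim0)).preorder.getLast? = some ⟨0, WithConst.const⟩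

end Term

/-- The covering relation on forests: either the selected internal node is the root of a term `t`
of the forest, which is grafted onto the rightmost leaf of the term on its left, or
it lies inside a term of the forest. -/
inductive ForestStep {S : ℕ → Type u} : List (Term S) → List (Term S) → Prop
  | root (p q : List (Term S)) (s t : Term S) :
      ForestStep (p ++ s :: t :: q) (p ++ s.graftRight t :: q)
  | inner (p q : List (Term S)) (t t' : Term S) (h : t.Step t') :
      ForestStep (p ++ t :: q) (p ++ t' :: q)

/-- Reduced forests: words of terms, none of which is the leaf. -/
def RForest (S : ℕ → Type u) : Type u := {f : List (Term S) // ∀ t ∈ f, t ≠ Term.leaf}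

namespace Term

variable {S : ℕ → Type u}

/-- The number of internal nodes. -/
def degree : Term S → ℕ
  | leaf => 0
  | node _ ts => 1 + ∑ i, (ts i).degree

/-- The multiset of decorations; auxiliary, for finiteness. -/
def content : Term S → Multiset (Σ n, S n)
  | leaf => 0
  | @node _ n g ts => {⟨n, g⟩} + ∑ i, (ts i).content

/-- Auxiliary statistic, strictly increasing along the easterly wind order. -/
def stat : Term S → ℕ
  | leaf => 0
  | @node _ n _ ts => ∑ i : Fin n, ((ts i).stat + (n - i) * (ts i).degree)

theorem degree_pos {t : Term S} (h : t ≠ leaf) : 0 < t.degree := by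
  cases t with
  | leaf => exact absurd rfl h
  | node g ts => simp [degree]

theorem card_content (t : Term S) : t.content.card = t.degree := by
  induction t with
  | leaf => rfl
  | node g ts ih => simp [content, degree, ih, add_comm]

theorem comp_ne_leaf {t : Term S} (h : t ≠ leaf) (σ : ℕ → Term S) : t.comp σ ≠ leaf := by
  cases t with
  | leaf => exact absurd rfl h
  | node g ts => simp [comp]

theorem sum_ite_last {M : Type*} [AddCommMonoid M] {n : ℕ} (a b : Fin (n + 1) → M) :
    ∑ i : Fin (n + 1), (if (i : ℕ) + 1 = n + 1 then b i else a i)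
      = (∑ i : Fin n, a i.castSucc) + b (Fin.last n) := by
  rw [Fin.sum_univ_castSucc]
  congr 1
  · refine Finset.sum_congr rfl fun i _ => ?_
    have := i.isLt
    rw [if_neg (by simp; omega)]
  · simp

theorem content_graftRight [IsEmpty (S 0)] (t s : Term S) :
    (t.graftRight s).content = t.content + s.content := by
  induction t with
  | leaf => simp [graftRight, content]
  | @node n g ts ih =>
    cases n with
    | zero => exact isEmptyElim g
    | succ n =>
      simp only [graftRight, content, apply_ite content, sum_ite_last, ih]
      rw [Fin.sum_univ_castSucc]
      simp only [add_assoc]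

theorem degree_graftRight [IsEmpty (S 0)] (t s : Term S) :
    (t.graftRight s).degree = t.degree + s.degree := by
  simp only [← card_content, content_graftRight, Multiset.card_add]

theorem stat_graftRight [IsEmpty (S 0)] (t s : Term S) :
    t.stat + s.stat ≤ (t.graftRight s).stat ∧
      (t ≠ leaf → t.stat + s.stat + s.degree ≤ (t.graftRight s).stat) := by
  induction t with
  | leaf => simp [graftRight, stat]
  | @node n g ts ih =>
    cases n with
    | zero => exact isEmptyElim g
    | succ n =>
      have key : (node g ts).stat + s.stat + s.degree ≤ ((node g ts).graftRight s).stat := by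
        have h1 : ((node g ts).graftRight s).stat
            = ∑ i : Fin (n + 1), (if (i : ℕ) + 1 = n + 1 then
                (((ts i).graftRight s).stat + (n + 1 - i) * ((ts i).graftRight s).degree)
                else ((ts i).stat + (n + 1 - i) * (ts i).degree)) := by
          simp only [graftRight, stat]
          refine Finset.sum_congr rfl fun i _ => ?_
          split_ifs <;> rfl
        rw [h1, sum_ite_last]
        simp only [stat]
        rw [Fin.sum_univ_castSucc]
        have h2 := (ih (Fin.last n)).1
        simp only [degree_graftRight, Fin.val_last, Nat.add_sub_cancel_left, one_mul,
          Fin.val_castSucc]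
        omega
      exact ⟨by omega, fun _ => key⟩

theorem sum_pair {n : ℕ} {M : Type*} [AddCommMonoid M] (a : Fin n → M) {i j : Fin n}
    (h : i ≠ j) : ∑ k, a k = a i + a j + ∑ k ∈ (Finset.univ.erase i).erase j, a k := by
  rw [← Finset.add_sum_erase _ a (Finset.mem_univ i),
    ← Finset.add_sum_erase _ a (Finset.mem_erase.2 ⟨h.symm, Finset.mem_univ j⟩), add_assoc]

theorem Step.content_eq [IsEmpty (S 0)] {t t' : Term S} (h : t.Step t') :
    t'.content = t.content := by
  induction h with
  | slide g ts i j hij hj =>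
    have hne : i ≠ j := by rintro rfl; omega
    simp only [content]
    rw [sum_pair _ hne, sum_pair (fun k => (ts k).content) hne]
    congr 1
    congr 1
    · simp [Function.update_of_ne hne, content_graftRight, content]
    · refine Finset.sum_congr rfl fun k hk => ?_
      simp only [Finset.mem_erase] at hk
      rw [Function.update_of_ne hk.1, Function.update_of_ne hk.2.1]
  | child g ts i t' _ ih =>
    simp only [content]
    congr 1
    refine Finset.sum_congr rfl fun k _ => ?_
    by_cases hk : k = i
    · subst hk; simp [ih]
    · rw [Function.update_of_ne hk]

theorem Step.degree_eq [IsEmpty (S 0)] {t t' : Term S} (h : t.Step t') :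
    t'.degree = t.degree := by
  simp only [← card_content, h.content_eq]

theorem Step.stat_lt [IsEmpty (S 0)] {t t' : Term S} (h : t.Step t') : t.stat < t'.stat := by
  induction h with
  | @slide n g ts i j hij hj =>
    have hne : i ≠ j := by rintro rfl; omega
    simp only [stat]
    rw [sum_pair (fun k : Fin n => (ts k).stat + (n - k) * (ts k).degree) hne, sum_pair _ hne]
    refine add_lt_add_of_lt_of_le ?_ (le_of_eq (Finset.sum_congr rfl fun k hk => ?_))
    · have h1 := (stat_graftRight (ts i) (ts j)).1
      have h2 := degree_pos hj
      have h3 : n - (i : ℕ) = (n - (j : ℕ)) + 1 := by have := j.isLt; omega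
      simp only [Function.update_of_ne hne, Function.update_self, stat, degree,
        degree_graftRight, h3]
      nlinarith
    · simp only [Finset.mem_erase] at hk
      rw [Function.update_of_ne hk.1, Function.update_of_ne hk.2.1]
  | @child n g ts i t' h ih =>
    simp only [stat]
    refine Finset.sum_lt_sum (fun k _ => ?_) ⟨i, Finset.mem_univ i, ?_⟩
    · by_cases hk : k = i
      · subst hk; simp only [Function.update_self, h.degree_eq]; omega
      · rw [Function.update_of_ne hk]
    · simp only [Function.update_self, h.degree_eq]; omega

theorem finite_content_le (W : Multiset (Σ n, S n)) (m : ℕ) :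
    {t : Term S | t.degree ≤ m ∧ t.content ≤ W}.Finite := by
  induction m with
  | zero =>
    refine (Set.finite_singleton (leaf : Term S)).subset ?_
    rintro t ⟨ht, -⟩
    by_contra hne
    have := degree_pos hne
    omega
  | succ m ih =>
    have hW : {p : Σ n, S n | p ∈ W}.Finite := by
      classical
      exact W.toFinset.finite_toSet.subset fun p hp => by simpa using hp
    refine ((Set.finite_singleton (leaf : Term S)).union (hW.biUnion fun p _ =>
      (Set.Finite.pi' (ι := Fin p.1) (fun _ => ih)).image (node p.2))).subset ?_
    rintro t ⟨ht, hc⟩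
    cases t with
    | leaf => exact Or.inl rfl
    | @node n g ts =>
      refine Or.inr (Set.mem_biUnion (x := (⟨n, g⟩ : Σ n, S n)) ?_ ⟨ts, fun i => ⟨?_, ?_⟩, rfl⟩)
      · exact Multiset.mem_of_le hc (by simp [content])
      · have := Finset.single_le_sum (f := fun i => (ts i).degree)
          (fun _ _ => Nat.zero_le _) (Finset.mem_univ i)
        simp only [degree] at ht
        omega
      · refine le_trans ?_ hc
        simp only [content]
        rw [← Finset.add_sum_erase _ _ (Finset.mem_univ i)]
        exact (Multiset.le_add_right _ _).trans (Multiset.le_add_left _ _)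

end Term

namespace RForest

variable {S : ℕ → Type u}

/-- The over operation: concatenation. -/
def opOver (f f' : RForest S) : RForest S :=
  ⟨f.1 ++ f'.1, fun t ht => (List.mem_append.1 ht).elim (f.2 t) (f'.2 t)⟩

/-- Reduced forests form a monoid under concatenation. -/
instance : Monoid (RForest S) where
  mul := opOver
  one := ⟨[], by simp⟩
  mul_assoc f g h := Subtype.ext (List.append_assoc f.1 g.1 h.1)
  one_mul f := Subtype.ext (List.nil_append f.1)
  mul_one f := Subtype.ext (List.append_nil f.1)

open Classical in
/-- Grafts the terms of `s` onto the extremal leaves of `t`: the `k`-th term goes onto the `k`-th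
leftmost extremal leaf of `t` (here `Nat.count t.IsExtremal i` is the number of extremal leaves
of `t` on the left of its `i`-th leaf), until there is no remaining term or no remaining
extremal leaf. The remaining terms are kept on the right. -/
noncomputable def underTerm (t : Term S) (s : List (Term S)) : List (Term S) :=
  (t.comp fun i =>
      if t.IsExtremal i then s.getD (Nat.count t.IsExtremal i) Term.leaf else Term.leaf) ::
    s.drop (Nat.count t.IsExtremal t.arity)

/-- The under operation on words of terms: the terms of the second word are grafted onto the
extremal leaves of the last term of the first word. -/
noncomputable def underList : List (Term S) → List (Term S) → List (Term S)
  | [], s => s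
  | [t], s => underTerm t s
  | t :: t' :: f, s => t :: underList (t' :: f) s

theorem underList_ne_leaf (f s : List (Term S)) (hf : ∀ t ∈ f, t ≠ Term.leaf)
    (hs : ∀ t ∈ s, t ≠ Term.leaf) : ∀ t ∈ underList f s, t ≠ Term.leaf := by
  induction f with
  | nil => exact hs
  | cons t f ih =>
    cases f with
    | nil =>
      intro r hr
      rcases List.mem_cons.1 hr with rfl | hr
      · exact Term.comp_ne_leaf (hf t (by simp)) _
      · exact hs r (List.mem_of_mem_drop hr)
    | cons t' f =>
      intro r hr
      rcases List.mem_cons.1 hr with rfl | hr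
      · exact hf _ (by simp)
      · exact ih (fun x hx => hf x (List.mem_cons_of_mem _ hx)) r hr

/-- The under operation on reduced forests. -/
noncomputable def opUnder (f f' : RForest S) : RForest S :=
  ⟨underList f.1 f'.1, underList_ne_leaf f.1 f'.1 f.2 f'.2⟩

/-- The covering relation `⇀` on reduced forests. -/
def Step (f f' : RForest S) : Prop := ForestStep f.1 f'.1

/-- The multiset of decorations; auxiliary, for finiteness. -/
def content (f : RForest S) : Multiset (Σ n, S n) := (f.1.map Term.content).sum

/-- Auxiliary statistic, strictly increasing along the easterly wind order. -/
def stat (f : RForest S) : ℕ := (f.1.map Term.stat).sum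

theorem Step.content_eq [IsEmpty (S 0)] {f f' : RForest S} (h : f.Step f') :
    f'.content = f.content := by
  obtain ⟨f, hf⟩ := f
  obtain ⟨f', hf'⟩ := f'
  change ForestStep f f' at h
  cases h with
  | root p q s t => simp [content, Term.content_graftRight, add_assoc]
  | inner p q t t' h => simp [content, h.content_eq]

theorem Step.stat_lt [IsEmpty (S 0)] {f f' : RForest S} (h : f.Step f') : f.stat < f'.stat := by
  obtain ⟨f, hf⟩ := f
  obtain ⟨f', hf'⟩ := f'
  change ForestStep f f' at h
  cases h with
  | root p q s t =>
    have h1 := (Term.stat_graftRight s t).2 (hf s (by simp))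
    have h2 := Term.degree_pos (hf t (by simp))
    simp only [stat, List.map_append, List.map_cons, List.sum_append, List.sum_cons]
    omega
  | inner p q t t' h =>
    have := h.stat_lt
    simp only [stat, List.map_append, List.map_cons, List.sum_append, List.sum_cons]
    omega

theorem content_eq_of_rtg [IsEmpty (S 0)] {f f' : RForest S} (h : Relation.ReflTransGen Step f f') :
    f'.content = f.content := by
  induction h with
  | refl => rfl
  | tail _ h ih => exact h.content_eq.trans ih

theorem eq_or_stat_lt_of_rtg [IsEmpty (S 0)] {f f' : RForest S}
    (h : Relation.ReflTransGen Step f f') : f = f' ∨ f.stat < f'.stat := by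
  induction h with
  | refl => exact Or.inl rfl
  | tail _ h ih =>
    rcases ih with rfl | ih
    · exact Or.inr h.stat_lt
    · exact Or.inr (ih.trans h.stat_lt)

/-- The easterly wind order: the reflexive and transitive closure of `⇀`. -/
instance [IsEmpty (S 0)] : PartialOrder (RForest S) where
  le := Relation.ReflTransGen Step
  le_refl _ := Relation.ReflTransGen.refl
  le_trans _ _ _ := Relation.ReflTransGen.trans
  le_antisymm f g h h' := by
    rcases eq_or_stat_lt_of_rtg h with h | h
    · exact h
    · rcases eq_or_stat_lt_of_rtg h' with h' | h'
      · exact h'.symm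
      · omega

theorem length_le_card_content (f : RForest S) : f.1.length ≤ f.content.card := by
  obtain ⟨f, hf⟩ := f
  simp only [content]
  induction f with
  | nil => simp
  | cons t f ih =>
    have h1 := Term.degree_pos (hf t (by simp))
    have h2 := ih fun x hx => hf x (List.mem_cons_of_mem _ hx)
    simp only [List.map_cons, List.sum_cons, Multiset.card_add, Term.card_content,
      List.length_cons]
    omega

theorem finite_content_eq (W : Multiset (Σ n, S n)) : {f : RForest S | f.content = W}.Finite := by
  have hA := Term.finite_content_le W W.card
  have : Finite {t : Term S | t.degree ≤ W.card ∧ t.content ≤ W} := hA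
  have hL := (List.finite_length_le {t : Term S | t.degree ≤ W.card ∧ t.content ≤ W} W.card).image
    (List.map Subtype.val)
  refine Set.Finite.of_finite_image (f := Subtype.val) (hL.subset ?_) Subtype.val_injective.injOn
  rintro _ ⟨f, hf, rfl⟩
  have hmem : ∀ t ∈ f.1, t ∈ {t : Term S | t.degree ≤ W.card ∧ t.content ≤ W} := by
    intro t ht
    have : t.content ≤ W := by
      rw [← (hf : f.content = W)]
      exact List.single_le_sum (fun _ _ => Multiset.zero_le _) _ (List.mem_map_of_mem ht)
    exact ⟨by rw [← Term.card_content]; exact Multiset.card_le_card this, this⟩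
  refine ⟨f.1.pmap Subtype.mk hmem, ?_, ?_⟩
  · have := length_le_card_content f
    rw [(hf : f.content = W)] at this
    change (f.1.pmap Subtype.mk hmem).length ≤ W.card
    simpa only [List.length_pmap] using this
  · simp [List.map_pmap]

theorem finite_Ici [IsEmpty (S 0)] (f : RForest S) : (Set.Ici f).Finite :=
  (finite_content_eq f.content).subset fun _ h => content_eq_of_rtg h

theorem finite_Iic [IsEmpty (S 0)] (f : RForest S) : (Set.Iic f).Finite :=
  (finite_content_eq f.content).subset fun _ h => (content_eq_of_rtg h).symm

noncomputable instance [IsEmpty (S 0)] : LocallyFiniteOrder (RForest S) :=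
  LocallyFiniteOrder.ofFiniteIcc fun f _ => (finite_Ici f).subset fun _ h => h.1

open Classical in
noncomputable instance [IsEmpty (S 0)] : LocallyFiniteOrderTop (RForest S) :=
  LocallyFiniteOrderTop.ofIci _ (fun f => (finite_Ici f).toFinset) fun f g => by simp

open Classical in
noncomputable instance [IsEmpty (S 0)] : LocallyFiniteOrderBot (RForest S) :=
  LocallyFiniteOrderBot.ofIic _ (fun f => (finite_Iic f).toFinset) fun f g => by simp

end RForest

/-- The algebra `N·T·S`: the `K`-linear span of the reduced forests, with the product extending
concatenation bilinearly. -/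
abbrev NatAlgebra (K : Type v) [Field K] (S : ℕ → Type u) : Type (max u v) :=
  MonoidAlgebra K (RForest S)

namespace NatAlgebra

variable (K : Type v) [Field K] {S : ℕ → Type u}

/-- The elementary basis. -/
noncomputable def E (f : RForest S) : NatAlgebra K S := MonoidAlgebra.single f 1

open Classical in
/-- The fundamental basis: `F f = ∑ μ(f, f') • E f'` over all `f' ≽ f`. -/
noncomputable def F [IsEmpty (S 0)] (f : RForest S) : NatAlgebra K S :=
  ∑ f' ∈ Finset.Ici f, IncidenceAlgebra.mu K f f' • E K f'

/-- The homogeneous basis: `H f = ∑ F f'` over all `f' ≼ f`. -/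
noncomputable def H [IsEmpty (S 0)] (f : RForest S) : NatAlgebra K S :=
  ∑ f' ∈ Finset.Iic f, F K f'

end NatAlgebra

/-! A step of the easterly wind order moves subterms but keeps the left to right preorder of the
internal nodes. A forest can therefore be cut at any `m`: its first `m` nodes in preorder form one
reduced forest, the remaining ones another, and this map `cut m` is monotone (`ForestStep.pre_suf`,
`cut_mono`). `cut g.degree` sends both the over and the under of `g` and `g'` to `(g, g')`, and
every forest lies between the over and the under of its two halves (`mem_Icc_cut`). By antisymmetry,
the fibres of the cut are exactly the intervals from over to under (`mem_Icc_iff_cut_eq`).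

The product formulas follow by summing over fibres. Möbius inversion writes `E f` as the sum of `F`
over the up-set of `f`. The cut partitions the up-set of `f / f'` into the intervals attached to the
pairs above `(f, f')`, so the formula for `F` holds once both arguments are summed over up-sets, and
such summation is injective. The formula for `H` follows from that for `F`, by partitioning the
down-set of `f \ f'` in the same way.

The combinatorial tool is `Plug t L T`: the leaves of `t` after its last node are slots, filled by
the word `L`. A forest `T :: U` is then encoded by the word `L ++ U`, in which filled slots and
later terms behave as brothers and leaves mark vacant places. Sliding everything left gives the
under operation; the over operation is the configuration with all slots of `t` vacant. -/

namespace Term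

variable {S : ℕ → Type u}

/-! ### Children as words: list forms of terms, steps and grafts -/

/-- Induction on terms where the children of a node are seen as a list. -/
theorem list_induction {P : Term S → Prop} (leaf : P leaf)
    (node : ∀ {n : ℕ} (g : S n) (ts : Fin n → Term S), (∀ t ∈ List.ofFn ts, P t) → P (node g ts))
    (t : Term S) : P t := by
  induction t with
  | leaf => exact leaf
  | node g ts ih =>
    refine node g ts fun t ht => ?_
    obtain ⟨i, rfl⟩ := (List.mem_ofFn' _ _).1 ht
    exact ih i

theorem exists_ofFn {n : ℕ} {L : List (Term S)} (h : L.length = n) :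
    ∃ ts : Fin n → Term S, List.ofFn ts = L := by
  subst h
  exact ⟨L.get, List.ofFn_get L⟩

/-- The word of the values of `h` on the terms of a word, where `h` is also given the total weight
of the preceding terms. -/
def scan {β : Type*} (w : Term S → ℕ) (h : ℕ → Term S → β) : ℕ → List (Term S) → List β
  | _, [] => []
  | a, t :: L => h a t :: scan w h (a + w t) L

/-- The recursions for `comp`, `pre` and `suf` shift each child by the total weight of its left
brothers. This turns them into recursions on words; the offset `a` is free so that induction goes
through. -/
theorem ofFn_eq_scan {β : Type*} (w : Term S → ℕ) (h : ℕ → Term S → β) {n : ℕ} (a : ℕ)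
    (ts : Fin n → Term S) :
    List.ofFn (fun k : Fin n => h (a + ∑ j : Fin k, w (ts (j.castLE k.isLt.le))) (ts k)) =
      scan w h a (List.ofFn ts) := by
  induction n generalizing a with
  | zero => simp [scan]
  | succ n ih =>
    simp only [List.ofFn_succ, scan]
    congr 1
    rw [← ih (a + w (ts 0)) fun i => ts i.succ]
    congr 1
    funext k
    congr 1
    simp only [Fin.val_succ]
    rw [Fin.sum_univ_succ, add_assoc]
    rfl

/-- The terms of a word that are not the leaf. -/
noncomputable def nonleaves (L : List (Term S)) : List (Term S) :=
  open Classical in L.filter (· ≠ leaf)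

@[simp] theorem nonleaves_nil : nonleaves ([] : List (Term S)) = [] := rfl

@[simp] theorem nonleaves_append (L M : List (Term S)) :
    nonleaves (L ++ M) = nonleaves L ++ nonleaves M := by simp [nonleaves]

@[simp] theorem nonleaves_cons_leaf (L : List (Term S)) :
    nonleaves (leaf :: L) = nonleaves L := by simp [nonleaves]

theorem nonleaves_cons {t : Term S} (h : t ≠ leaf) (L : List (Term S)) :
    nonleaves (t :: L) = t :: nonleaves L := by simp [nonleaves, h]

@[simp] theorem nonleaves_replicate (k : ℕ) :
    nonleaves (List.replicate k (leaf : Term S)) = [] := by simp [nonleaves]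

theorem mem_nonleaves {t : Term S} {L : List (Term S)} :
    t ∈ nonleaves L ↔ t ∈ L ∧ t ≠ leaf := by simp [nonleaves]

theorem nonleaves_eq_self {L : List (Term S)} (h : ∀ t ∈ L, t ≠ leaf) : nonleaves L = L := by
  simpa [nonleaves] using h

theorem eq_replicate_of_nonleaves_eq_nil {L : List (Term S)} (h : nonleaves L = []) :
    L = List.replicate L.length leaf := by
  rw [List.eq_replicate_iff]
  refine ⟨rfl, fun t ht => ?_⟩
  by_contra hne
  have : t ∈ nonleaves L := mem_nonleaves.2 ⟨ht, hne⟩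
  simp [h] at this

/-- The covering relation on words of brothers: the list version of `Term.Step`. -/
inductive BStep : List (Term S) → List (Term S) → Prop
  | slide (p q : List (Term S)) (x v : Term S) (hv : v ≠ leaf) :
      BStep (p ++ x :: v :: q) (p ++ x.graftRight v :: leaf :: q)
  | child (p q : List (Term S)) (t t' : Term S) (h : t.Step t') :
      BStep (p ++ t :: q) (p ++ t' :: q)

theorem BStep.length_eq {L M : List (Term S)} (h : BStep L M) : M.length = L.length := by
  cases h <;> simp

theorem BStep.context {L M : List (Term S)} (h : BStep L M) (p q : List (Term S)) :
    BStep (p ++ L ++ q) (p ++ M ++ q) := by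
  cases h with
  | slide p' q' x v hv => simpa using BStep.slide (p ++ p') (q' ++ q) x v hv
  | child p' q' t t' h => simpa using BStep.child (p ++ p') (q' ++ q) t t' h

theorem ofFn_update {α : Type*} {n : ℕ} (ts : Fin n → α) (i : Fin n) (t : α) :
    List.ofFn (Function.update ts i t) = (List.ofFn ts).set i t := by
  refine List.ext_getElem (by simp) fun k h1 h2 => ?_
  simp only [List.getElem_ofFn, List.getElem_set, Function.update_apply, Fin.ext_iff]
  simp only [eq_comm]

/-- Allows steps below a root to be studied by splitting words, without indices or
`Function.update`. -/
theorem step_node_iff {n : ℕ} {g : S n} {ts ts' : Fin n → Term S} :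
    (node g ts).Step (node g ts') ↔ BStep (List.ofFn ts) (List.ofFn ts') := by
  constructor
  · intro h
    -- The endpoints become variables tied by equations, so that the case analysis need not unify
    -- the dependent data of two nodes.
    have key : ∀ (t t' : Term S), t.Step t' → ∀ {n : ℕ} (g : S n) (ts ts' : Fin n → Term S),
        t = node g ts → t' = node g ts' → BStep (List.ofFn ts) (List.ofFn ts') := by
      intro t t' h
      cases h with
      | @slide n g ts i j hij hj =>
        intro n' g' us us' h1 h2
        cases h1
        cases h2
        rw [ofFn_update, ofFn_update]
        have hL : List.ofFn ts = (List.ofFn ts).take i ++ ts i :: ts j ::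
            (List.ofFn ts).drop (i + 2) := by
          conv_lhs => rw [← List.take_append_drop i (List.ofFn ts)]
          rw [List.drop_eq_getElem_cons (by simp), List.drop_eq_getElem_cons (by simp; omega)]
          have := j.isLt
          simp [hij]
          omega
        have hlen : ((List.ofFn ts).take i).length = i := by simp
        generalize (List.ofFn ts).take i = p at *
        generalize (List.ofFn ts).drop (i + 2) = q at *
        rw [hL, ← hij, ← hlen]
        simpa using BStep.slide p q _ _ hj
      | @child n g ts i t' h =>
        intro n' g' us us' h1 h2
        cases h1
        cases h2
        rw [ofFn_update]
        have hL : List.ofFn ts = (List.ofFn ts).take i ++ ts i ::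
            (List.ofFn ts).drop (i + 1) := by
          conv_lhs => rw [← List.take_append_drop i (List.ofFn ts)]
          rw [List.drop_eq_getElem_cons (by simp)]
          simp
        have hlen : ((List.ofFn ts).take i).length = i := by simp
        generalize (List.ofFn ts).take i = p at *
        generalize (List.ofFn ts).drop (i + 1) = q at *
        rw [hL, ← hlen]
        simpa using BStep.child p q _ _ h
    exact key _ _ h g ts ts' rfl rfl
  · intro h
    generalize hL : List.ofFn ts = L at h
    generalize hM : List.ofFn ts' = M at h
    cases h with
    | slide p q x v hv =>
      have hn : n = p.length + (q.length + 1 + 1) := by simpa using congrArg List.length hL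
      have hx : ts ⟨p.length, by omega⟩ = x := by
        have : (List.ofFn ts)[p.length]'(by simp; omega) = x := by simp [hL]
        simpa using this
      have hv' : ts ⟨p.length + 1, by omega⟩ = v := by
        have : (List.ofFn ts)[p.length + 1]'(by simp; omega) = v := by simp [hL]
        simpa using this
      have := Step.slide g ts ⟨p.length, by omega⟩ ⟨p.length + 1, by omega⟩ rfl (by rwa [hv'])
      convert this
      apply List.ofFn_injective
      rw [ofFn_update, ofFn_update, hx, hv', hL, hM]
      simp
    | child p q t t' h =>
      have hn : n = p.length + (q.length + 1) := by simpa using congrArg List.length hL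
      have hx : ts ⟨p.length, by omega⟩ = t := by
        have : (List.ofFn ts)[p.length]'(by simp; omega) = t := by simp [hL]
        simpa using this
      have := Step.child g ts ⟨p.length, by omega⟩ t' (by rwa [hx])
      convert this
      apply List.ofFn_injective
      rw [ofFn_update, hL, hM]
      simp

theorem Step.exists_node {n : ℕ} {g : S n} {ts : Fin n → Term S} {t' : Term S}
    (h : (node g ts).Step t') : ∃ ts', t' = node g ts' := by
  cases h <;> exact ⟨_, rfl⟩

theorem Step.ne_leaf {t t' : Term S} (h : t.Step t') : t ≠ leaf ∧ t' ≠ leaf := by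
  cases h <;> simp

@[simp] theorem leaf_graftRight (s : Term S) : leaf.graftRight s = s := rfl

theorem graftRight_ne_leaf {t : Term S} (h : t ≠ leaf) (s : Term S) : t.graftRight s ≠ leaf := by
  cases t with
  | leaf => exact absurd rfl h
  | node g ts => simp [graftRight]

theorem graftRight_eq_leaf_iff {t s : Term S} : t.graftRight s = leaf ↔ t = leaf ∧ s = leaf := by
  cases t <;> simp [graftRight]

/-- The total number of internal nodes of a word of terms. -/
def degreeL (L : List (Term S)) : ℕ := (L.map degree).sum

theorem degree_node {n : ℕ} (g : S n) (ts : Fin n → Term S) :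
    (node g ts).degree = 1 + degreeL (List.ofFn ts) := by
  simp [degree, degreeL, List.sum_ofFn]


theorem exists_ofFn_eq_append [IsEmpty (S 0)] {n : ℕ} (g : S n) (ts : Fin n → Term S) :
    ∃ p x, List.ofFn ts = p ++ [x] := by
  have : List.ofFn ts ≠ [] := by
    rcases n with _ | n
    · exact isEmptyElim g
    · simp
  exact ⟨_, _, (List.dropLast_append_getLast this).symm⟩

theorem graftRight_node {n : ℕ} (g : S n) {ts : Fin n → Term S} {p : List (Term S)} {x : Term S}
    (h : List.ofFn ts = p ++ [x]) (s : Term S) :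
    ∃ ts', (node g ts).graftRight s = node g ts' ∧ List.ofFn ts' = p ++ [x.graftRight s] := by
  refine ⟨_, rfl, ?_⟩
  have hn : n = p.length + 1 := by simpa using congrArg List.length h
  subst hn
  rw [List.ofFn_succ', List.concat_eq_append] at h ⊢
  obtain ⟨h1, h2⟩ := List.append_inj' h rfl
  simp only [List.cons.injEq, and_true] at h2
  rw [← h2]
  congr 1
  · refine Eq.trans ?_ h1
    congr 1
    funext i
    rw [if_neg (by simpa using i.isLt.ne)]
  · simp

variable [IsEmpty (S 0)]

@[simp] theorem graftRight_leaf (t : Term S) : t.graftRight leaf = t := by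
  induction t using list_induction with
  | leaf => rfl
  | node g ts ih =>
    obtain ⟨p, x, h⟩ := exists_ofFn_eq_append g ts
    obtain ⟨ts', h1, h2⟩ := graftRight_node g h leaf
    rw [h1]
    congr 1
    apply List.ofFn_injective
    rw [h2, h, ih x (by simp [h])]

end Term

/-! ### Cutting a term after its first nodes in preorder -/

namespace Term

variable {S : ℕ → Type u}

@[simp] theorem degreeL_nil : degreeL ([] : List (Term S)) = 0 := rfl

@[simp] theorem degreeL_cons (t : Term S) (L : List (Term S)) :
    degreeL (t :: L) = t.degree + degreeL L := by simp [degreeL]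

@[simp] theorem degreeL_append (L M : List (Term S)) :
    degreeL (L ++ M) = degreeL L + degreeL M := by simp [degreeL]

@[simp] theorem degree_leaf : (leaf : Term S).degree = 0 := rfl

@[simp] theorem degreeL_replicate (k : ℕ) :
    degreeL (List.replicate k (leaf : Term S)) = 0 := by simp [degreeL]

/-- The term formed by the first `m` internal nodes of a term, in preorder. -/
def pre : Term S → ℕ → Term S
  | leaf, _ => leaf
  | node _ _, 0 => leaf
  | node g ts, m + 1 =>
    node g fun k => (ts k).pre (m - (0 + ∑ j : Fin k, (ts (j.castLE k.isLt.le)).degree))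

/-- The word of the maximal subterms, different from the leaf, of a term that avoid its first `m`
internal nodes in preorder. -/
def suf : Term S → ℕ → List (Term S)
  | leaf, _ => []
  | node g ts, 0 => [node g ts]
  | @node _ _ _ ts, m + 1 =>
    (List.ofFn fun k =>
      (ts k).suf (m - (0 + ∑ j : Fin k, (ts (j.castLE k.isLt.le)).degree))).flatten

/-- The list version of `Term.pre`. -/
def preL : ℕ → List (Term S) → List (Term S)
  | _, [] => []
  | m, t :: L => t.pre m :: preL (m - t.degree) L

/-- The list version of `Term.suf`. -/
def sufL : ℕ → List (Term S) → List (Term S)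
  | _, [] => []
  | m, t :: L => t.suf m ++ sufL (m - t.degree) L

theorem scan_pre (m a : ℕ) (L : List (Term S)) :
    scan degree (fun b t => t.pre (m - b)) a L = preL (m - a) L := by
  induction L generalizing a with
  | nil => rfl
  | cons t L ih => simp [scan, preL, ih, Nat.sub_sub]

theorem scan_suf (m a : ℕ) (L : List (Term S)) :
    (scan degree (fun b t => t.suf (m - b)) a L).flatten = sufL (m - a) L := by
  induction L generalizing a with
  | nil => rfl
  | cons t L ih => simp [scan, sufL, ih, Nat.sub_sub]

theorem pre_node {n : ℕ} (g : S n) (ts : Fin n → Term S) (m : ℕ) :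
    ∃ ts', (node g ts).pre (m + 1) = node g ts' ∧ List.ofFn ts' = preL m (List.ofFn ts) :=
  ⟨_, rfl, (ofFn_eq_scan degree (fun b t => t.pre (m - b)) 0 ts).trans (scan_pre m 0 _)⟩

theorem suf_node {n : ℕ} (g : S n) (ts : Fin n → Term S) (m : ℕ) :
    (node g ts).suf (m + 1) = sufL m (List.ofFn ts) :=
  (congrArg List.flatten (ofFn_eq_scan degree (fun b t => t.suf (m - b)) 0 ts)).trans
    (scan_suf m 0 _)

@[simp] theorem pre_leaf (m : ℕ) : (leaf : Term S).pre m = leaf := by rw [pre]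

@[simp] theorem suf_leaf (m : ℕ) : (leaf : Term S).suf m = [] := by rw [suf]

@[simp] theorem pre_zero (t : Term S) : t.pre 0 = leaf := by cases t <;> rw [pre]

theorem suf_zero (t : Term S) : t.suf 0 = nonleaves [t] := by
  cases t
  · simp
  · rw [suf, nonleaves_cons (by simp), nonleaves_nil]

theorem nonleaves_cons_eq (t : Term S) (L : List (Term S)) :
    nonleaves (t :: L) = nonleaves [t] ++ nonleaves L := by
  rw [← nonleaves_append, List.singleton_append]

@[simp] theorem preL_zero (L : List (Term S)) : preL 0 L = List.replicate L.length leaf := by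
  induction L <;> simp [preL, List.replicate_succ, *]

@[simp] theorem sufL_zero (L : List (Term S)) : sufL 0 L = nonleaves L := by
  induction L with
  | nil => rfl
  | cons t L ih => rw [nonleaves_cons_eq, sufL, Nat.zero_sub, ih, suf_zero]

theorem preL_append (m : ℕ) (L M : List (Term S)) :
    preL m (L ++ M) = preL m L ++ preL (m - degreeL L) M := by
  induction L generalizing m <;> simp [preL, Nat.sub_sub, *]

theorem sufL_append (m : ℕ) (L M : List (Term S)) :
    sufL m (L ++ M) = sufL m L ++ sufL (m - degreeL L) M := by
  induction L generalizing m <;> simp [sufL, Nat.sub_sub, *]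

theorem preL_sufL_of_forall {L : List (Term S)}
    (h : ∀ t ∈ L, ∀ m, t.degree ≤ m → t.pre m = t ∧ t.suf m = []) {m : ℕ} (hm : degreeL L ≤ m) :
    preL m L = L ∧ sufL m L = [] := by
  induction L generalizing m with
  | nil => exact ⟨rfl, rfl⟩
  | cons t L ih =>
    rw [degreeL_cons] at hm
    have h1 := h t (by simp) m (by omega)
    have h2 := ih (fun t ht => h t (by simp [ht])) (m := m - t.degree) (by omega)
    simp [preL, sufL, h1, h2]

theorem pre_suf_of_degree_le (t : Term S) :
    ∀ m, t.degree ≤ m → t.pre m = t ∧ t.suf m = [] := by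
  induction t using list_induction with
  | leaf => simp
  | node g ts ih =>
    intro m hm
    rw [degree_node] at hm
    obtain ⟨m, rfl⟩ : ∃ m', m = m' + 1 := ⟨m - 1, by omega⟩
    have := preL_sufL_of_forall ih (m := m) (by omega)
    obtain ⟨ts', h1, h2⟩ := pre_node g ts m
    rw [h1, suf_node, this.2]
    rw [this.1] at h2
    rw [List.ofFn_injective h2]
    exact ⟨rfl, rfl⟩

theorem preL_of_degreeL_le {L : List (Term S)} {m : ℕ} (hm : degreeL L ≤ m) : preL m L = L :=
  (preL_sufL_of_forall (fun t _ => pre_suf_of_degree_le t) hm).1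

theorem sufL_of_degreeL_le {L : List (Term S)} {m : ℕ} (hm : degreeL L ≤ m) : sufL m L = [] :=
  (preL_sufL_of_forall (fun t _ => pre_suf_of_degree_le t) hm).2

/-- The easterly wind order on words of terms. -/
abbrev FLe : List (Term S) → List (Term S) → Prop := Relation.ReflTransGen ForestStep

/-- The reflexive and transitive closure of `Term.BStep`. -/
abbrev BLe : List (Term S) → List (Term S) → Prop := Relation.ReflTransGen BStep

theorem _root_.ForestStep.context {f f' : List (Term S)} (h : ForestStep f f')
    (p q : List (Term S)) : ForestStep (p ++ f ++ q) (p ++ f' ++ q) := by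
  cases h with
  | root p' q' s t => simpa using ForestStep.root (p ++ p') (q' ++ q) s t
  | inner p' q' t t' h => simpa using ForestStep.inner (p ++ p') (q' ++ q) t t' h

theorem FLe.context {f f' : List (Term S)} (h : FLe f f') (p q : List (Term S)) :
    FLe (p ++ f ++ q) (p ++ f' ++ q) :=
  Relation.ReflTransGen.lift (fun f => p ++ f ++ q) (fun _ _ h => h.context p q) _ _ h

theorem BLe.context {f f' : List (Term S)} (h : BLe f f') (p q : List (Term S)) :
    BLe (p ++ f ++ q) (p ++ f' ++ q) :=
  Relation.ReflTransGen.lift (fun f => p ++ f ++ q) (fun _ _ h => h.context p q) _ _ h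

theorem BLe.length_eq {L M : List (Term S)} (h : BLe L M) : M.length = L.length := by
  induction h with
  | refl => rfl
  | tail _ h ih => rw [h.length_eq, ih]

theorem BLe.node {n : ℕ} (g : S n) {ts ts' : Fin n → Term S}
    (h : BLe (List.ofFn ts) (List.ofFn ts')) :
    Relation.ReflTransGen Step (node g ts) (node g ts') := by
  generalize hM : List.ofFn ts' = M at h
  induction h generalizing ts' with
  | refl => rw [List.ofFn_injective hM]
  | @tail L M h1 h2 ih =>
    have : L.length = n := by simpa using BLe.length_eq h1
    obtain ⟨us, rfl⟩ := exists_ofFn this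
    subst hM
    exact (ih rfl).tail (step_node_iff.2 h2)

theorem BLe.child {t t' : Term S} (h : Relation.ReflTransGen Step t t') (p q : List (Term S)) :
    BLe (p ++ t :: q) (p ++ t' :: q) :=
  Relation.ReflTransGen.lift (fun t => p ++ t :: q) (fun _ _ h => BStep.child p q _ _ h) _ _ h

/-- Sliding onto a leaf only moves the vacant place, which erasing leaves hides; sliding onto a
proper term is a root step of forests. -/
theorem BStep.nonleaves {L M : List (Term S)} (h : BStep L M) :
    FLe (nonleaves L) (nonleaves M) := by
  cases h with
  | slide p q x v hv =>
    by_cases hx : x = leaf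
    · subst hx
      simp [nonleaves_cons hv, Relation.ReflTransGen.refl]
    · simp only [nonleaves_append, nonleaves_cons hv, nonleaves_cons hx, nonleaves_cons_leaf,
        nonleaves_cons (graftRight_ne_leaf hx v)]
      exact Relation.ReflTransGen.single (ForestStep.root _ _ _ _)
  | child p q t t' h =>
    simp only [nonleaves_append, nonleaves_cons h.ne_leaf.1, nonleaves_cons h.ne_leaf.2]
    exact Relation.ReflTransGen.single (ForestStep.inner _ _ _ _ h)

theorem BLe.nonleaves {L M : List (Term S)} (h : BLe L M) :
    FLe (nonleaves L) (nonleaves M) := by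
  induction h with
  | refl => exact Relation.ReflTransGen.refl
  | tail _ h ih => exact ih.trans h.nonleaves

variable [IsEmpty (S 0)]

/-- The rightmost leaf comes after all nodes of `a`, so the nodes of `a` are used up first;
truncated subtraction covers a cut inside `a`. -/
theorem pre_graftRight (a b : Term S) (m : ℕ) :
    (a.graftRight b).pre m = (a.pre m).graftRight (b.pre (m - a.degree)) := by
  induction a using list_induction generalizing m with
  | leaf => simp
  | node g ts ih =>
    obtain ⟨p, x, h⟩ := exists_ofFn_eq_append g ts
    obtain ⟨ts', h1, h2⟩ := graftRight_node g h b
    rcases m with _ | m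
    · simp
    obtain ⟨us, h3, h4⟩ := pre_node g ts m
    obtain ⟨us', h5, h6⟩ := pre_node g ts' m
    rw [h, preL_append] at h4
    obtain ⟨vs, h7, h8⟩ := graftRight_node g h4 (b.pre (m + 1 - (node g ts).degree))
    rw [h1, h5, h3, h7]
    congr 1
    apply List.ofFn_injective
    rw [h6, h8, h2, preL_append, preL, preL, ih x (by simp [h]), degree_node, h]
    simp only [degreeL_append, degreeL_cons, degreeL_nil, add_zero]
    congr 4
    omega

/-- Only an inequality: when the cut passes before `a`, the left side has the two terms `a` and `b`,
and one root step joins them. Otherwise the comparison descends to the last child. -/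
theorem suf_graftRight (a b : Term S) (m : ℕ) :
    FLe (a.suf m ++ b.suf (m - a.degree)) ((a.graftRight b).suf m) := by
  induction a using list_induction generalizing m with
  | leaf => simp [Relation.ReflTransGen.refl]
  | node g ts ih =>
    obtain ⟨p, x, h⟩ := exists_ofFn_eq_append g ts
    obtain ⟨ts', h1, h2⟩ := graftRight_node g h b
    rcases m with _ | m
    · have hne : node g ts ≠ leaf := by simp
      by_cases hb : b = leaf
      · subst hb
        simp [Relation.ReflTransGen.refl]
      · simp only [suf_zero, Nat.zero_sub, nonleaves_cons hne, nonleaves_cons hb,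
          nonleaves_cons (graftRight_ne_leaf hne b)]
        exact Relation.ReflTransGen.single (ForestStep.root [] [] _ _)
    · rw [h1, suf_node, suf_node, h2, h, sufL_append, sufL_append, degree_node, h]
      simp only [degreeL_append, degreeL_cons, degreeL_nil, add_zero, sufL, List.append_nil]
      have := FLe.context (ih x (by simp [h]) (m - degreeL p)) (sufL m p) []
      have e : m + 1 - (1 + (degreeL p + x.degree)) = m - degreeL p - x.degree := by omega
      rw [e]
      simpa using this

/-- A slide preserves preorder, so both halves follow it: the first half slides the kept part of
`v`, or stands still if that part is a leaf, and the second is handled by `suf_graftRight`. -/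
theorem preL_sufL_mono {L M : List (Term S)} (h : BStep L M)
    (ih : ∀ t ∈ L, ∀ t', t.Step t' → ∀ m,
      Relation.ReflTransGen Step (t.pre m) (t'.pre m) ∧ FLe (t.suf m) (t'.suf m)) (m : ℕ) :
    BLe (preL m L) (preL m M) ∧ FLe (sufL m L) (sufL m M) := by
  cases h with
  | slide p q x v hv =>
    simp only [preL_append, preL, sufL_append, sufL, pre_graftRight, degree_graftRight,
      degree_leaf, Nat.sub_zero, suf_leaf, pre_leaf, Nat.sub_sub, List.nil_append, ← add_assoc]
    constructor
    · by_cases h : v.pre (m - (degreeL p + x.degree)) = leaf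
      · simp [h, Relation.ReflTransGen.refl]
      · exact Relation.ReflTransGen.single (BStep.slide _ _ _ _ h)
    · have := FLe.context (suf_graftRight x v (m - degreeL p)) (sufL m p)
        (sufL (m - (degreeL p + x.degree + v.degree)) q)
      simpa [Nat.sub_sub] using this
  | child p q t t' h =>
    simp only [preL_append, preL, sufL_append, sufL, h.degree_eq]
    have := ih t (by simp) t' h (m - degreeL p)
    refine ⟨BLe.child this.1 _ _, ?_⟩
    simpa using FLe.context this.2 (sufL m p) (sufL (m - degreeL p - t.degree) q)

theorem Step.pre_suf {t t' : Term S} (h : t.Step t') (m : ℕ) :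
    Relation.ReflTransGen Step (t.pre m) (t'.pre m) ∧ FLe (t.suf m) (t'.suf m) := by
  induction t using list_induction generalizing t' m with
  | leaf => exact absurd rfl h.ne_leaf.1
  | node g ts ih =>
    obtain ⟨ts', rfl⟩ := h.exists_node
    rcases m with _ | m
    · simp only [pre_zero, suf_zero, nonleaves_cons h.ne_leaf.1, nonleaves_cons h.ne_leaf.2]
      exact ⟨Relation.ReflTransGen.refl,
        Relation.ReflTransGen.single (ForestStep.inner [] [] _ _ h)⟩
    · obtain ⟨us, h1, h2⟩ := pre_node g ts m
      obtain ⟨us', h3, h4⟩ := pre_node g ts' m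
      have := preL_sufL_mono (step_node_iff.1 h) (fun t ht t' h m => ih t ht h m) m
      rw [h1, h3, suf_node, suf_node]
      rw [← h2, ← h4] at this
      exact ⟨this.1.node g, this.2⟩

/-- A root step is a slide of brothers followed by erasing the leaf left behind, so everything
reduces to `BStep`. -/
theorem _root_.ForestStep.pre_suf {f f' : List (Term S)} (h : ForestStep f f')
    (hf : ∀ t ∈ f, t ≠ leaf) (m : ℕ) :
    FLe (nonleaves (preL m f)) (nonleaves (preL m f')) ∧ FLe (sufL m f) (sufL m f') := by
  have key : ∀ {L M : List (Term S)}, BStep L M →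
      FLe (nonleaves (preL m L)) (nonleaves (preL m M)) ∧ FLe (sufL m L) (sufL m M) := by
    intro L M h
    have := preL_sufL_mono h (fun t _ t' h m => h.pre_suf m) m
    exact ⟨this.1.nonleaves, this.2⟩
  cases h with
  | root p q s t =>
    have := key (BStep.slide p q s t (hf t (by simp)))
    simpa only [preL_append, preL, sufL_append, sufL, degree_leaf, Nat.sub_zero, suf_leaf, pre_leaf,
      List.nil_append, nonleaves_append, nonleaves_cons_leaf,
      nonleaves_cons_eq (pre _ _) (_ :: _), nonleaves_cons_eq (pre _ _) (preL _ _)] using this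
  | inner p q t t' h => exact key (BStep.child p q t t' h)

end Term

/-! ### Plugging a word into the slots after the last node -/

namespace Term

variable {S : ℕ → Type u}

/-- `Plug t L T`: the term `T` is obtained from `t` by grafting the terms of the word `L` onto the
leaves of `t` that follow its last internal node in preorder. -/
inductive Plug : Term S → List (Term S) → Term S → Prop
  | leaf (x : Term S) : Plug leaf [x] x
  | node {n : ℕ} (g : S n) (ts ts' : Fin n → Term S) (p U L : List (Term S)) (t T : Term S)
      (h : List.ofFn ts = p ++ t :: List.replicate U.length leaf)
      (h' : List.ofFn ts' = p ++ T :: U) (hp : t ≠ leaf ∨ p = []) (hP : Plug t L T) :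
      Plug (node g ts) (L ++ U) (node g ts')

theorem Plug.degree_eq {t T : Term S} {L : List (Term S)} (h : Plug t L T) :
    T.degree = t.degree + degreeL L := by
  induction h with
  | leaf x => simp
  | node g ts ts' p U L t T h h' hp hP ih =>
    rw [degree_node, degree_node, h, h']
    simp
    omega

theorem Plug.ne_leaf {t T : Term S} {L : List (Term S)} (h : Plug t L T) (ht : t ≠ Term.leaf) :
    T ≠ Term.leaf := by
  cases h with
  | leaf x => exact absurd rfl ht
  | node => simp

/-- All nodes of `t` precede those plugged in, so cutting after `t.degree` nodes undoes the
plugging. -/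
theorem Plug.pre_suf {t T : Term S} {L : List (Term S)} (h : Plug t L T) :
    T.pre t.degree = t ∧ T.suf t.degree = nonleaves L := by
  induction h with
  | leaf x => simp [suf_zero]
  | node g ts ts' p U L t T h h' hp hP ih =>
    have hd := hP.degree_eq
    obtain ⟨us, h1, h2⟩ := pre_node g ts' (degreeL (List.ofFn ts))
    have e : degreeL p + t.degree - degreeL p = t.degree := by omega
    have e' : t.degree - T.degree = 0 := by omega
    rw [degree_node, add_comm, h1, suf_node]
    rw [h', h, preL_append, preL_of_degreeL_le (by simp)] at h2
    rw [h', h, sufL_append, sufL_of_degreeL_le (by simp)]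
    simp only [degreeL_append, degreeL_cons, degreeL_replicate, add_zero, e, preL, e', sufL, ih.1,
      ih.2, preL_zero, sufL_zero, nonleaves_append, List.nil_append, and_true] at h2 ⊢
    rw [← h] at h2
    rw [List.ofFn_injective h2]

/-- The side condition makes `t` the last child that is not a leaf, or the first child when all are
leaves; this makes the decomposition in `Plug.node` unique. -/
theorem append_cons_replicate_inj {p p' : List (Term S)} {t t' : Term S} {k k' : ℕ}
    (h : p ++ t :: List.replicate k leaf = p' ++ t' :: List.replicate k' leaf)
    (hp : t ≠ leaf ∨ p = []) (hp' : t' ≠ leaf ∨ p' = []) : p = p' ∧ t = t' ∧ k = k' := by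
  induction p generalizing p' with
  | nil =>
    cases p' with
    | nil =>
      simp only [List.nil_append, List.cons.injEq] at h
      exact ⟨rfl, h.1, by simpa using congrArg List.length h.2⟩
    | cons x p' =>
      simp only [List.nil_append, List.cons_append, List.cons.injEq] at h
      have : t' ∈ List.replicate k leaf := by rw [h.2]; simp
      simp [List.eq_of_mem_replicate this] at hp'
  | cons x p ih =>
    have ht : t ≠ leaf := by simpa using hp
    cases p' with
    | nil =>
      simp only [List.nil_append, List.cons_append, List.cons.injEq] at h
      have : t ∈ List.replicate k' leaf := by rw [← h.2]; simp
      exact absurd (List.eq_of_mem_replicate this) ht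
    | cons x' p' =>
      have ht' : t' ≠ leaf := by simpa using hp'
      simp only [List.cons_append, List.cons.injEq] at h
      obtain ⟨rfl, h2, h3⟩ := ih h.2 (Or.inl ht) (Or.inl ht')
      exact ⟨by rw [h.1], h2, h3⟩

theorem Plug.unique {t T T' : Term S} {L L' : List (Term S)} (h : Plug t L T) (h' : Plug t L' T') :
    L.length = L'.length ∧ (L = L' → T = T') := by
  induction h generalizing L' T' with
  | leaf x =>
    cases h'
    simp
  | node g ts ts' p U L t T h1 h2 hp hP ih =>
    cases h' with
    | node _ _ us' p' U' L' t' T' h1' h2' hp' hP' =>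
      obtain ⟨rfl, rfl, hU⟩ := append_cons_replicate_inj (h1.symm.trans h1') hp hp'
      have := ih hP'
      refine ⟨by simp [this.1, hU], fun e => ?_⟩
      obtain ⟨e1, rfl⟩ := List.append_inj' e hU
      congr 1
      apply List.ofFn_injective
      rw [h2, h2', this.2 e1]

/-- Every cut of a word happens inside one child: those before it are kept whole, those after it
lose all their nodes. -/
theorem exists_plug_preL {Ls : List (Term S)} (hne : Ls ≠ [])
    (ih : ∀ T ∈ Ls, ∀ m, ∃ L, Plug (T.pre m) L T ∧ T.suf m = nonleaves L) (m : ℕ) :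
    ∃ p t T L U, Ls = p ++ T :: U ∧ preL m Ls = p ++ t :: List.replicate U.length leaf ∧
      (t ≠ leaf ∨ p = []) ∧ Plug t L T ∧ sufL m Ls = nonleaves (L ++ U) := by
  induction Ls generalizing m with
  | nil => exact absurd rfl hne
  | cons T Ls ihL =>
    obtain ⟨L, hL, hs⟩ := ih T (by simp) m
    -- Case where no node of the tail is kept, so that the head is the child being cut.
    have key : preL (m - T.degree) Ls = List.replicate Ls.length leaf →
        sufL (m - T.degree) Ls = nonleaves Ls → ∃ p t T' L U, T :: Ls = p ++ T' :: U ∧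
          preL m (T :: Ls) = p ++ t :: List.replicate U.length leaf ∧
          (t ≠ leaf ∨ p = []) ∧ Plug t L T' ∧ sufL m (T :: Ls) = nonleaves (L ++ U) := by
      intro h1 h2
      exact ⟨[], _, T, L, Ls, rfl, by simp [preL, h1], Or.inr rfl, hL, by simp [sufL, hs, h2]⟩
    by_cases hLs : Ls = []
    · subst hLs
      exact key rfl rfl
    obtain ⟨p, t, T', L', U, rfl, h1, h2, h3, h4⟩ :=
      ihL hLs (fun T hT => ih T (by simp [hT])) (m - T.degree)
    by_cases ht : t = leaf
    · subst ht
      obtain rfl : p = [] := by simpa using h2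
      cases h3
      exact key (by simpa [List.replicate_succ] using h1) h4
    -- A node of the tail is kept, hence the head is exhausted and kept whole.
    · have hm : T.degree ≤ m := by
        by_contra hm
        rw [Nat.sub_eq_zero_of_le (by omega), preL_zero] at h1
        have : t ∈ List.replicate (p ++ T' :: U).length leaf := by rw [h1]; simp
        exact ht (List.eq_of_mem_replicate this)
      have := pre_suf_of_degree_le T m hm
      exact ⟨T :: p, t, T', L', U, rfl, by simp [preL, h1, this.1], Or.inl ht, h3,
        by simp [sufL, h4, this.2]⟩

/-- Besides moves internal to a factor, the only move is the first term of `U` sliding onto the last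
term of `L`. -/
theorem BStep.of_append {L U M : List (Term S)} (h : BStep (L ++ U) M) :
    (∃ L', BStep L L' ∧ M = L' ++ U) ∨ (∃ U', BStep U U' ∧ M = L ++ U') ∨
      ∃ L₀ x v U₀, L = L₀ ++ [x] ∧ U = v :: U₀ ∧ v ≠ leaf ∧
        M = L₀ ++ x.graftRight v :: leaf :: U₀ := by
  generalize hN : L ++ U = N at h
  cases h with
  | slide p q x v hv =>
    rcases List.append_eq_append_iff.1 hN with ⟨A, rfl, rfl⟩ | ⟨A, rfl, hA⟩
    · exact Or.inr (Or.inl ⟨_, BStep.slide A q x v hv, by simp⟩)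
    · rcases A with _ | ⟨a, A⟩
      · simp only [List.nil_append] at hA
        subst hA
        exact Or.inr (Or.inl ⟨_, BStep.slide [] q x v hv, by simp⟩)
      · simp only [List.cons_append, List.cons.injEq] at hA
        obtain ⟨rfl, hA⟩ := hA
        rcases A with _ | ⟨a, A⟩
        · exact Or.inr (Or.inr ⟨p, x, v, q, rfl, by simpa using hA.symm, hv, rfl⟩)
        · simp only [List.cons_append, List.cons.injEq] at hA
          obtain ⟨rfl, rfl⟩ := hA
          exact Or.inl ⟨_, BStep.slide p A x v hv, by simp⟩
  | child p q t t' h =>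
    rcases List.append_eq_append_iff.1 hN with ⟨A, rfl, rfl⟩ | ⟨A, rfl, hA⟩
    · exact Or.inr (Or.inl ⟨_, BStep.child A q t t' h, by simp⟩)
    · rcases A with _ | ⟨a, A⟩
      · simp only [List.nil_append] at hA
        subst hA
        exact Or.inr (Or.inl ⟨_, BStep.child [] q t t' h, by simp⟩)
      · simp only [List.cons_append, List.cons.injEq] at hA
        obtain ⟨rfl, rfl⟩ := hA
        exact Or.inl ⟨_, BStep.child p A t t' h, by simp⟩

theorem BStep.of_singleton {t : Term S} {M : List (Term S)} (h : BStep [t] M) :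
    ∃ t', t.Step t' ∧ M = [t'] := by
  generalize hN : [t] = N at h
  cases h with
  | slide p q x v hv =>
    have := congrArg List.length hN
    simp at this
    omega
  | child p q t t' h =>
    rcases p with _ | ⟨a, p⟩
    · simp only [List.nil_append, List.cons.injEq] at hN
      obtain ⟨rfl, rfl⟩ := hN
      exact ⟨t', h, rfl⟩
    · simpa using congrArg List.length hN

theorem BStep.exists_ne_leaf {L M : List (Term S)} (h : BStep L M) : ∃ t ∈ L, t ≠ leaf := by
  cases h with
  | slide p q x v hv => exact ⟨v, by simp, hv⟩
  | child p q t t' h => exact ⟨t, by simp, h.ne_leaf.1⟩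

/-- The last slot of `t` is its rightmost leaf, so the rightmost leaf of `T` is that of the last
plugged term. -/
theorem Plug.graftRight_last {t T : Term S} {L₀ : List (Term S)} {x : Term S}
    (h : Plug t (L₀ ++ [x]) T) (v : Term S) :
    Plug t (L₀ ++ [x.graftRight v]) (T.graftRight v) := by
  generalize hL : L₀ ++ [x] = L at h
  induction h generalizing L₀ with
  | leaf y =>
    obtain ⟨rfl, e⟩ := List.append_inj' (hL.trans (List.nil_append [y]).symm) rfl
    cases e
    exact Plug.leaf _
  | node g ts ts' p U L t T h h' hp hP ih =>
    rcases List.eq_nil_or_concat' U with rfl | ⟨U₀, y, rfl⟩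
    · obtain ⟨us, h1, h2⟩ := graftRight_node g h' v
      rw [h1]
      simpa using Plug.node g ts us p [] _ t _ h h2 hp (ih (by simpa using hL))
    · rw [← List.append_assoc] at hL
      obtain ⟨rfl, e⟩ := List.append_inj' hL rfl
      cases e
      have h'' : List.ofFn ts' = (p ++ T :: U₀) ++ [x] := by simp [h']
      obtain ⟨us, h1, h2⟩ := graftRight_node g h'' v
      rw [h1]
      simpa using Plug.node g ts us p (U₀ ++ [x.graftRight v]) L t T (by simpa using h)
        (by simp [h2]) hp hP

/-- Slots act as brothers even when they lie at different depths: a slide between levels is realised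
by grafting onto the rightmost leaf of `T`. -/
theorem Plug.bstep {t T : Term S} {L M : List (Term S)} (h : Plug t L T) (hL : BStep L M) :
    ∃ T', Plug t M T' ∧ T.Step T' := by
  induction h generalizing M with
  | leaf x =>
    obtain ⟨t', h, rfl⟩ := hL.of_singleton
    exact ⟨t', Plug.leaf t', h⟩
  | @node n g ts ts' p U L t T h h' hp hP ih =>
    have hlen : n = p.length + (U.length + 1) := by simpa using congrArg List.length h'
    have key : ∀ T' U' L', BStep (p ++ T :: U) (p ++ T' :: U') → U'.length = U.length →
        Plug t L' T' → ∃ T'', Plug (Term.node g ts) (L' ++ U') T'' ∧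
          (Term.node g ts').Step T'' := by
      intro T' U' L' hB hU hP'
      obtain ⟨us, hus⟩ := exists_ofFn (n := n) (L := p ++ T' :: U') (by simp [hU, hlen])
      exact ⟨Term.node g us, Plug.node g ts us p U' L' t T' (by rw [hU, h]) hus hp hP',
        step_node_iff.2 (by rwa [h', hus])⟩
    rcases hL.of_append with ⟨L', h1, rfl⟩ | ⟨U', h1, rfl⟩ | ⟨L₀, x, v, U₀, rfl, rfl, hv, rfl⟩
    · obtain ⟨T', h2, h3⟩ := ih h1
      exact key T' U L' (BStep.child p U T T' h3) rfl h2
    · exact key T U' L (by simpa using h1.context (p ++ [T]) []) h1.length_eq hP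
    · simpa using key _ (Term.leaf :: U₀) _ (BStep.slide p U₀ T v hv) rfl (hP.graftRight_last v)

variable [IsEmpty (S 0)]

theorem exists_plug_pre (T : Term S) (m : ℕ) :
    ∃ L, Plug (T.pre m) L T ∧ T.suf m = nonleaves L := by
  induction T using list_induction generalizing m with
  | leaf => exact ⟨[leaf], by simpa using Plug.leaf leaf, by simp⟩
  | @node n g ts ih =>
    rcases m with _ | m
    · exact ⟨[node g ts], by simpa using Plug.leaf _, suf_zero _⟩
    have hne : List.ofFn ts ≠ [] := by
      obtain ⟨p, x, h⟩ := exists_ofFn_eq_append g ts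
      simp [h]
    obtain ⟨p, t, T, L, U, h1, h2, h3, h4, h5⟩ := exists_plug_preL hne ih m
    obtain ⟨us, h6, h7⟩ := pre_node g ts m
    refine ⟨L ++ U, ?_, by rw [suf_node, h5]⟩
    rw [h6]
    exact Plug.node g us ts p U L t T (h7.trans h2) h1 h3 h4

/-- The last node of the graft lies in `t`, so the slots are unchanged. For `t` a leaf this fails,
since the slots of `s` would count as well. -/
theorem Plug.graftRight_left {t T : Term S} {L : List (Term S)} (h : Plug t L T)
    (ht : t ≠ Term.leaf) (s : Term S) : Plug (s.graftRight t) L (s.graftRight T) := by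
  induction s using list_induction with
  | leaf => exact h
  | node g ts ih =>
    obtain ⟨p, x, hp⟩ := exists_ofFn_eq_append g ts
    obtain ⟨us, h1, h2⟩ := graftRight_node g hp t
    obtain ⟨us', h3, h4⟩ := graftRight_node g hp T
    rw [h1, h3]
    have hne : x.graftRight t ≠ Term.leaf := by simp [graftRight_eq_leaf_iff, ht]
    simpa using Plug.node g us us' p [] L _ _ h2 h4 (Or.inl hne) (ih x (by simp [hp]))

/-- A step of `t` may create a slot, so the plugged word is kept only up to leaves. -/
theorem Plug.step {t T t₁ : Term S} {L : List (Term S)} (h : Plug t L T) (ht : t.Step t₁) :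
    ∃ L₁ T₁, Plug t₁ L₁ T₁ ∧ nonleaves L₁ = nonleaves L ∧ T.Step T₁ := by
  induction h generalizing t₁ with
  | leaf x => exact absurd rfl ht.ne_leaf.1
  | @node n g ts ts' p U L t T h h' hp hP ih =>
    obtain ⟨us, rfl⟩ := ht.exists_node
    rw [step_node_iff, h] at ht
    have hlen : n = p.length + (U.length + 1) := by simpa using congrArg List.length h'
    have key : ∀ p₁ U₁ L₁ t₁ T₁,
        List.ofFn us = p₁ ++ t₁ :: List.replicate U₁.length Term.leaf →
        BStep (p ++ T :: U) (p₁ ++ T₁ :: U₁) → t₁ ≠ Term.leaf ∨ p₁ = [] → Plug t₁ L₁ T₁ →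
        nonleaves (L₁ ++ U₁) = nonleaves (L ++ U) → ∃ L' T', Plug (Term.node g us) L' T' ∧
          nonleaves L' = nonleaves (L ++ U) ∧ (Term.node g ts').Step T' := by
      intro p₁ U₁ L₁ t₁ T₁ h1 hB h2 h3 h4
      obtain ⟨us', hus'⟩ := exists_ofFn (n := n) (L := p₁ ++ T₁ :: U₁)
        (by have := hB.length_eq; simp at this ⊢; omega)
      exact ⟨_, _, Plug.node g us us' p₁ U₁ L₁ t₁ T₁ h1 hus' h2 h3, h4,
        step_node_iff.2 (by rwa [h', hus'])⟩
    rcases ht.of_append with ⟨p', h1, h2⟩ | ⟨U', h1, h2⟩ | ⟨L₀, x, v, U₀, rfl, h1, hv, h2⟩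
    · have hne : t ≠ Term.leaf := by
        refine hp.resolve_right ?_
        rintro rfl
        obtain ⟨t, ht, -⟩ := h1.exists_ne_leaf
        simp at ht
      exact key p' U L t T h2 (by simpa using h1.context [] (T :: U)) (Or.inl hne) hP rfl
    · rw [← List.singleton_append] at h1
      rcases h1.of_append with ⟨p', h3, rfl⟩ | ⟨U', h3, rfl⟩ | ⟨L₀, x, v, U₀, h3, h4, hv, rfl⟩
      · obtain ⟨t', h4, rfl⟩ := h3.of_singleton
        obtain ⟨L₁, T₁, h5, h6, h7⟩ := ih h4
        exact key p U L₁ t' T₁ h2 (BStep.child _ _ _ _ h7) (Or.inl h4.ne_leaf.2) h5 (by simp [h6])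
      · obtain ⟨t, ht, hne⟩ := h3.exists_ne_leaf
        exact absurd (List.eq_of_mem_replicate ht) hne
      · have : v ∈ List.replicate U.length Term.leaf := by rw [h4]; simp
        exact absurd (List.eq_of_mem_replicate this) hv
    · simp only [List.cons.injEq] at h1
      obtain ⟨rfl, rfl⟩ := h1
      -- The child carrying the last node slides onto its left brother; the place it vacates is a
      -- new empty slot between `L` and `U`.
      refine key L₀ (Term.leaf :: U) L _ _ (by simpa [List.replicate_succ] using h2)
        (by simpa using BStep.slide L₀ U x T (hP.ne_leaf hv)) (Or.inl ?_) (hP.graftRight_left hv x)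
        (by simp)
      simp [graftRight_eq_leaf_iff, hv]

end Term

/-! ### Extremal leaves are the slots of `Plug` -/

namespace Term

variable {S : ℕ → Type u}

theorem scan_append {β : Type*} (w : Term S → ℕ) (h : ℕ → Term S → β) (a : ℕ)
    (L M : List (Term S)) :
    scan w h a (L ++ M) = scan w h a L ++ scan w h (a + (L.map w).sum) M := by
  induction L generalizing a <;> simp [scan, add_assoc, *]

theorem arity_node {n : ℕ} (g : S n) (ts : Fin n → Term S) :
    (node g ts).arity = ((List.ofFn ts).map arity).sum := by
  simp [arity, List.sum_ofFn]

@[simp] theorem arity_leaf : (leaf : Term S).arity = 1 := rfl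

theorem comp_node {n : ℕ} (g : S n) (ts : Fin n → Term S) (σ : ℕ → Term S) :
    ∃ us, (node g ts).comp σ = node g us ∧
      List.ofFn us = scan arity (fun a t => t.comp fun i => σ (a + i)) 0 (List.ofFn ts) := by
  refine ⟨_, rfl, ?_⟩
  rw [← ofFn_eq_scan]
  simp

theorem scan_comp_replicate (σ : ℕ → Term S) (a k : ℕ) :
    scan arity (fun a t => t.comp fun i => σ (a + i)) a (List.replicate k leaf) =
      (List.range' a k).map σ := by
  induction k generalizing a with
  | zero => rfl
  | succ k ih => simp [List.replicate_succ, scan, ih, List.range'_succ, comp]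

theorem scan_comp_eq_self {L : List (Term S)} {σ : ℕ → Term S}
    (ih : ∀ t ∈ L, ∀ σ : ℕ → Term S, (∀ i < t.arity, σ i = leaf) → t.comp σ = t) {a : ℕ}
    (h : ∀ i < (L.map arity).sum, σ (a + i) = leaf) :
    scan arity (fun a t => t.comp fun i => σ (a + i)) a L = L := by
  induction L generalizing a with
  | nil => rfl
  | cons t L ihL =>
    simp only [List.map_cons, List.sum_cons] at h
    simp only [scan]
    congr 1
    · exact ih t (by simp) _ fun i hi => h i (by omega)
    · refine ihL (fun t ht => ih t (by simp [ht])) fun i hi => ?_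
      rw [add_assoc]
      exact h _ (by omega)

theorem comp_eq_self (t : Term S) :
    ∀ σ : ℕ → Term S, (∀ i < t.arity, σ i = leaf) → t.comp σ = t := by
  induction t using list_induction with
  | leaf => exact fun σ h => h 0 (by simp)
  | node g ts ih =>
    intro σ h
    obtain ⟨us, h1, h2⟩ := comp_node g ts σ
    rw [arity_node] at h
    rw [scan_comp_eq_self ih (by simpa using h)] at h2
    rw [h1, List.ofFn_injective h2]

theorem arity_map {S' : ℕ → Type v} (φ : ∀ n, S n → S' n) (t : Term S) :
    (t.map φ).arity = t.arity := by
  induction t with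
  | leaf => rfl
  | node g ts ih => simp [map, arity, ih]

theorem map_node {S' : ℕ → Type v} (φ : ∀ n, S n → S' n) {n : ℕ} (g : S n) (ts : Fin n → Term S) :
    ∃ us, (node g ts).map φ = node (φ n g) us ∧ List.ofFn us = (List.ofFn ts).map (map φ) :=
  ⟨_, rfl, by simp [List.map_ofFn, Function.comp_def]⟩

theorem preorder_node {n : ℕ} (g : S n) (ts : Fin n → Term S) :
    (node g ts).preorder = ⟨n, g⟩ :: ((List.ofFn ts).map preorder).flatten := by
  simp [preorder, List.map_ofFn, Function.comp_def]

theorem preorder_ne_nil {t : Term S} (h : t ≠ leaf) : t.preorder ≠ [] := by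
  cases t with
  | leaf => exact absurd rfl h
  | node g ts => simp [preorder]

/-- Inclusion of the terms on `S` into the terms on the signature with a new constant. -/
abbrev withConst (t : Term S) : Term (WithConst S) := t.map fun _ g => WithConst.base g

/-- The term with a single internal node, decorated by the new constant. -/
abbrev constTerm : Term (WithConst S) := node WithConst.const Fin.elim0

theorem const_notMem_preorder (t : Term S) :
    (⟨0, WithConst.const⟩ : Σ n, WithConst S n) ∉ t.withConst.preorder := by
  induction t with
  | leaf => simp [map, preorder]
  | @node n g ts ih =>
    simp only [map, preorder, List.mem_cons, List.mem_flatten, List.mem_ofFn', Set.mem_range,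
      not_or, not_exists, not_and]
    refine ⟨fun h => ?_, ?_⟩
    · obtain ⟨rfl, h⟩ := Sigma.mk.inj h
      cases h
    · rintro _ ⟨i, rfl⟩
      exact ih i

theorem flatten_preorder_range' (b k i : ℕ) :
    (((List.range' b k).map fun j => if j = i then (constTerm : Term (WithConst S)) else leaf).map
      preorder).flatten = if b ≤ i ∧ i < b + k then [⟨0, WithConst.const⟩] else [] := by
  induction k generalizing b with
  | zero => simp
  | succ k ih =>
    simp only [List.range'_succ, List.map_cons, List.flatten_cons, ih]
    by_cases h : b = i
    · subst h
      simp [preorder]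
    · rw [if_neg h]
      simp only [preorder, List.nil_append]
      congr 1
      simp only [eq_iff_iff]
      omega

/-- The last node lies in the last child `t` that is not a leaf: leaves before `t` are never
extremal, all leaf children after it are, and inside `t` the question recurs. -/
theorem isExtremal_node {n : ℕ} (g : S n) {ts : Fin n → Term S} {p : List (Term S)} {t : Term S}
    {k : ℕ} (h : List.ofFn ts = p ++ t :: List.replicate k leaf) (hp : t ≠ leaf ∨ p = []) (i : ℕ) :
    (node g ts).IsExtremal i ↔
      ((p.map arity).sum ≤ i ∧ t.IsExtremal (i - (p.map arity).sum)) ∨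
      ((p.map arity).sum + t.arity ≤ i ∧ i < (p.map arity).sum + t.arity + k) := by
  set a := (p.map arity).sum with ha
  obtain ⟨us, h1, h2⟩ := map_node (fun _ g => WithConst.base g) g ts
  obtain ⟨vs, h3, h4⟩ := comp_node (WithConst.base g) us fun j => if j = i then constTerm else leaf
  have hpre : ((node g ts).withConst.partialComp i constTerm).preorder = ⟨n, WithConst.base g⟩ ::
      ((scan arity (fun a t => t.comp fun j => if a + j = i then constTerm else leaf) 0
        (p.map withConst)).map preorder).flatten ++
      (t.withConst.comp fun j => if a + j = i then constTerm else leaf).preorder ++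
      if a + t.arity ≤ i ∧ i < a + t.arity + k then [⟨0, WithConst.const⟩] else [] := by
    have e : (p.map (arity ∘ withConst)).sum = a := by
      rw [ha]
      congr 2
      funext t
      exact arity_map _ t
    rw [partialComp, withConst, h1, h3, preorder_node, h4, h2, h, ← flatten_preorder_range',
      ← scan_comp_replicate]
    simp [scan_append, scan, map, arity_map, e]
  have har : (node g ts).arity = a + t.arity + k := by
    simp [arity_node, h, ha, add_assoc]
  rw [IsExtremal, har, hpre]
  by_cases hi : a + t.arity ≤ i
  · have hne : ¬ t.IsExtremal (i - a) := fun h => by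
      have := h.1
      omega
    simp only [hne, hi, and_false, true_and, false_or]
    by_cases hk : i < a + t.arity + k
    · simp only [hk, and_self, if_true, List.getLast?_append, List.getLast?_singleton,
        Option.some_or]
    · simp [hk]
  · rw [if_neg (by tauto), List.append_nil]
    simp only [hi, false_and, or_false]
    by_cases hai : a ≤ i
    · have e : (fun j => if a + j = i then (constTerm : Term (WithConst S)) else leaf) =
          fun j => if j = i - a then constTerm else leaf := by
        funext j
        congr 1
        simp only [eq_iff_iff]
        omega
      rw [e]
      have hne : t.withConst.comp (fun j => if j = i - a then constTerm else leaf) ≠ leaf := by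
        cases t with
        | leaf =>
          have : i - a = 0 := by simp at hi; omega
          simp [map, comp, this]
        | node g ts => exact comp_ne_leaf (by simp [map]) _
      obtain ⟨l, x, hx⟩ := (List.eq_nil_or_concat' _).resolve_left (preorder_ne_nil hne)
      have h1 : i < a + t.arity + k := by omega
      have h2 : i - a < t.arity := by omega
      simp only [h1, hai, true_and, IsExtremal, h2]
      rw [partialComp]
      simp only [withConst] at hx
      rw [hx, ← List.append_assoc, List.getLast?_append, List.getLast?_append]
      simp
    -- The grafted leaf lies in `p`, so the preorder ends with a node of `t`, which never carries
    -- the new constant.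
    · have ht : t ≠ leaf := by
        refine hp.resolve_right ?_
        rintro rfl
        simp [ha] at hai
      have e : t.withConst.comp (fun j => if a + j = i then constTerm else leaf) =
          t.withConst := comp_eq_self _ _ fun j _ => if_neg (by omega)
      simp only [hai, false_and, iff_false, not_and]
      intro _ h
      have hne : t.withConst.preorder ≠ [] := preorder_ne_nil (by cases t <;> simp_all [map])
      obtain ⟨l, x, hx⟩ := (List.eq_nil_or_concat' _).resolve_left hne
      rw [e, hx, ← List.append_assoc, List.getLast?_append] at h
      simp only [List.getLast?_singleton, Option.some_or, Option.some.injEq] at h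
      refine const_notMem_preorder t ?_
      rw [hx, h]
      simp

theorem exists_eq_append_cons_replicate {L : List (Term S)} (h : L ≠ []) :
    ∃ p t k, L = p ++ t :: List.replicate k leaf ∧ (t ≠ leaf ∨ p = []) := by
  induction L with
  | nil => exact absurd rfl h
  | cons x L ih =>
    by_cases hL : L = []
    · exact ⟨[], x, 0, by simp [hL], Or.inr rfl⟩
    obtain ⟨p, t, k, rfl, hp⟩ := ih hL
    by_cases ht : t = leaf
    · subst ht
      obtain rfl : p = [] := by simpa using hp
      exact ⟨[], x, k + 1, by simp [List.replicate_succ], Or.inr rfl⟩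
    · exact ⟨x :: p, t, k, rfl, Or.inl ht⟩

variable [IsEmpty (S 0)]

/-- Extremal leaves form a final segment, starting at `b`, and composition supported there is a
plugging. -/
theorem exists_isExtremal_iff (t : Term S) : ∃ b ≤ t.arity,
    (∀ i, t.IsExtremal i ↔ b ≤ i ∧ i < t.arity) ∧
    ∀ σ : ℕ → Term S, (∀ i < b, σ i = leaf) →
      Plug t ((List.range' b (t.arity - b)).map σ) (t.comp σ) := by
  induction t using list_induction with
  | leaf =>
    refine ⟨0, by simp, fun i => ?_, fun σ _ => Plug.leaf _⟩
    simp only [IsExtremal, arity_leaf, Nat.lt_one_iff, zero_le, true_and, and_iff_left_iff_imp]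
    rintro rfl
    simp [map, partialComp, comp, preorder]
  | node g ts ih =>
    have hne : List.ofFn ts ≠ [] := by
      obtain ⟨p, x, h⟩ := exists_ofFn_eq_append g ts
      simp [h]
    obtain ⟨p, t, k, h, hp⟩ := exists_eq_append_cons_replicate hne
    obtain ⟨b, hb, h1, h2⟩ := ih t (by simp [h])
    set a := (p.map arity).sum with ha
    have har : (node g ts).arity = a + t.arity + k := by
      simp [arity_node, h, ha, add_assoc]
    refine ⟨a + b, by omega, fun i => ?_, fun σ hσ => ?_⟩
    · rw [isExtremal_node g h hp, h1, har]
      omega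
    · obtain ⟨us, h3, h4⟩ := comp_node g ts σ
      rw [h, scan_append, scan_comp_eq_self (fun t _ => comp_eq_self t)
        (fun i hi => hσ _ (by omega)), scan, scan_comp_replicate] at h4
      have hP := Plug.node g ts us p ((List.range' (0 + a + t.arity) k).map σ) _ t _
        (by simpa using h) h4 hp (h2 (fun i => σ (0 + a + i)) fun i hi => hσ _ (by omega))
      rw [h3]
      convert hP using 1
      have e : (fun i => σ (0 + a + i)) = σ ∘ fun i => a + i := by
        funext i
        simp
      rw [e, ← List.map_map, ← List.map_append, List.map_add_range']
      congr 1
      have e1 : 0 + a + t.arity = a + b + (t.arity - b) := by omega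
      have e2 : (node g ts).arity - (a + b) = t.arity - b + k := by omega
      rw [e1, e2, List.range'_append_1]

end Term

/-! ### The under operation: bounds and monotonicity -/

namespace Term

variable {S : ℕ → Type u}

theorem count_eq_sub {P : ℕ → Prop} [DecidablePred P] {a b : ℕ}
    (h : ∀ i, P i ↔ b ≤ i ∧ i < a) {i : ℕ} (hi : i ≤ a) : Nat.count P i = i - b := by
  induction i with
  | zero => simp
  | succ i ih =>
    rw [Nat.count_succ, ih (by omega)]
    by_cases hb : b ≤ i
    · rw [if_pos ((h i).2 ⟨hb, hi⟩)]
      omega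
    · rw [if_neg (fun h' => hb ((h i).1 h').1)]
      omega

/-- A vacant place travels right as each term in turn slides onto it. -/
theorem BLe.leaf_cons {s : List (Term S)} (hs : ∀ t ∈ s, t ≠ leaf) :
    BLe (leaf :: s) (s ++ [leaf]) := by
  induction s with
  | nil => exact Relation.ReflTransGen.refl
  | cons v s ih =>
    refine Relation.ReflTransGen.head (BStep.slide [] s leaf v (hs v (by simp))) ?_
    simpa using BLe.context (ih fun t ht => hs t (by simp [ht])) [v] []

theorem BLe.replicate_append {v : Term S} (hv : v ≠ leaf) (c : ℕ) :
    BLe (List.replicate c leaf ++ [v]) (v :: List.replicate c leaf) := by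
  induction c with
  | zero => exact Relation.ReflTransGen.refl
  | succ c ih =>
    rw [List.replicate_succ]
    refine Relation.ReflTransGen.tail (b := leaf :: v :: List.replicate c leaf) ?_
      (BStep.slide [] _ leaf v hv)
    simpa using BLe.context ih [leaf] []

theorem nonleaves_ne_leaf (L : List (Term S)) : ∀ t ∈ nonleaves L, t ≠ leaf :=
  fun _ h => (mem_nonleaves.1 h).2

/-- Packing all terms to the left goes up in the order; the next lemma starts from the packing to
the right. -/
theorem exists_bLe_nonleaves_append (L : List (Term S)) :
    ∃ c, BLe L (nonleaves L ++ List.replicate c leaf) := by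
  induction L with
  | nil => exact ⟨0, Relation.ReflTransGen.refl⟩
  | cons x L ih =>
    obtain ⟨c, hc⟩ := ih
    have h1 : BLe (x :: L) (x :: (nonleaves L ++ List.replicate c leaf)) := by
      simpa using BLe.context hc [x] []
    by_cases hx : x = leaf
    · subst hx
      refine ⟨c + 1, h1.trans ?_⟩
      simpa [List.replicate_succ] using
        BLe.context (BLe.leaf_cons (nonleaves_ne_leaf L)) [] (List.replicate c leaf)
    · exact ⟨c, by simpa [nonleaves_cons hx] using h1⟩

theorem exists_replicate_append_bLe (L : List (Term S)) :
    ∃ c, BLe (List.replicate c leaf ++ nonleaves L) L := by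
  induction L with
  | nil => exact ⟨0, Relation.ReflTransGen.refl⟩
  | cons x L ih =>
    obtain ⟨c, hc⟩ := ih
    have h1 : BLe (x :: (List.replicate c leaf ++ nonleaves L)) (x :: L) := by
      simpa using BLe.context hc [x] []
    by_cases hx : x = leaf
    · subst hx
      exact ⟨c + 1, by simpa [List.replicate_succ] using h1⟩
    · refine ⟨c, Relation.ReflTransGen.trans ?_ h1⟩
      simpa [nonleaves_cons hx] using
        BLe.context (BLe.replicate_append hx c) [] (nonleaves L)

/-- Moves of the encoding word are moves of the forest: a slide across the boundary of `L` and `U`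
becomes a root step onto `T`. -/
theorem Plug.exists_fLe_of_bStep {t T : Term S} {L U M : List (Term S)} (h : Plug t L T)
    (hM : BStep (L ++ U) M) :
    ∃ L' U' T', M = L' ++ U' ∧ Plug t L' T' ∧ FLe (T :: nonleaves U) (T' :: nonleaves U') := by
  rcases hM.of_append with ⟨L', h1, rfl⟩ | ⟨U', h1, rfl⟩ | ⟨L₀, x, v, U₀, rfl, rfl, hv, rfl⟩
  · obtain ⟨T', h2, h3⟩ := h.bstep h1
    exact ⟨L', U, T', rfl, h2, Relation.ReflTransGen.single (ForestStep.inner [] _ _ _ h3)⟩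
  · exact ⟨L, U', T, rfl, h, by simpa using FLe.context h1.nonleaves [T] []⟩
  · refine ⟨_, Term.leaf :: U₀, _, by simp, h.graftRight_last v, ?_⟩
    rw [nonleaves_cons hv, nonleaves_cons_leaf]
    exact Relation.ReflTransGen.single (ForestStep.root [] _ _ _)

theorem Plug.exists_fLe {t T : Term S} {L U M : List (Term S)} (h : Plug t L T)
    (hM : BLe (L ++ U) M) :
    ∃ L' U' T', M = L' ++ U' ∧ Plug t L' T' ∧ FLe (T :: nonleaves U) (T' :: nonleaves U') := by
  induction hM with
  | refl => exact ⟨L, U, T, rfl, h, Relation.ReflTransGen.refl⟩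
  | tail _ h2 ih =>
    obtain ⟨L₁, U₁, T₁, rfl, h3, h4⟩ := ih
    obtain ⟨L₂, U₂, T₂, rfl, h5, h6⟩ := h3.exists_fLe_of_bStep h2
    exact ⟨L₂, U₂, T₂, rfl, h5, h4.trans h6⟩

theorem underList_concat (p : List (Term S)) (t : Term S) (s : List (Term S)) :
    RForest.underList (p ++ [t]) s = p ++ RForest.underTerm t s := by
  induction p with
  | nil => rfl
  | cons x p ih =>
    cases p with
    | nil => rfl
    | cons y p =>
      simp only [List.cons_append, RForest.underList] at ih ⊢
      rw [ih]

/-- A root step shortens the forest but leaves a vacant place among brothers; pushing it to the end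
lengthens the padding by one. -/
theorem _root_.ForestStep.exists_bLe {s s' : List (Term S)} (h : ForestStep s s')
    (hs : ∀ t ∈ s, t ≠ leaf) (c : ℕ) :
    ∃ c', BLe (s ++ List.replicate c leaf) (s' ++ List.replicate c' leaf) := by
  cases h with
  | root p q x v =>
    refine ⟨c + 1, ?_⟩
    have h1 := (BStep.slide p q x v (hs v (by simp))).context [] (List.replicate c leaf)
    have h2 := BLe.context (BLe.leaf_cons (s := q) fun t ht => hs t (by simp [ht]))
      (p ++ [x.graftRight v]) (List.replicate c leaf)
    refine Relation.ReflTransGen.head (by simpa using h1) ?_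
    simpa [List.replicate_succ] using h2
  | inner p q t t' h =>
    exact ⟨c, Relation.ReflTransGen.single
      (by simpa using (BStep.child p q t t' h).context [] (List.replicate c leaf))⟩

theorem _root_.ForestStep.ne_leaf {s s' : List (Term S)} (h : ForestStep s s')
    (hs : ∀ t ∈ s, t ≠ leaf) : ∀ t ∈ s', t ≠ leaf := by
  cases h with
  | root p q x v =>
    intro t ht
    simp only [List.mem_append, List.mem_cons] at ht
    rcases ht with ht | rfl | ht
    · exact hs t (by simp [ht])
    · exact graftRight_ne_leaf (hs x (by simp)) v
    · exact hs t (by simp [ht])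
  | inner p q x x' h =>
    intro t ht
    simp only [List.mem_append, List.mem_cons] at ht
    rcases ht with ht | rfl | ht
    · exact hs t (by simp [ht])
    · exact h.ne_leaf.2
    · exact hs t (by simp [ht])

variable [IsEmpty (S 0)]

theorem exists_plug_underTerm (t : Term S) (s : List (Term S)) :
    ∃ L T, Plug t L T ∧ RForest.underTerm t s = T :: s.drop L.length ∧
      ∀ i (h : i < L.length), L[i] = s.getD i leaf := by
  classical
  obtain ⟨b, hb, h1, h2⟩ := exists_isExtremal_iff t
  refine ⟨_, _, h2 (fun i => if t.IsExtremal i then s.getD (i - b) leaf else leaf)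
    fun i hi => if_neg fun h => ?_, ?_, fun i h => ?_⟩
  · have := ((h1 i).1 h).1
    omega
  · rw [RForest.underTerm]
    congr 1
    · congr 1
      funext i
      split_ifs with h
      · rw [count_eq_sub h1 ((h1 i).1 h).2.le]
      · rfl
    · rw [count_eq_sub h1 le_rfl]
      simp
  · simp only [List.length_map, List.length_range'] at h
    simp only [List.getElem_map, List.getElem_range']
    rw [if_pos ((h1 _).2 (by omega))]
    simp

/-- Characterises the under operation: the encoding word is `s` packed to the left and padded by
leaves. -/
theorem Plug.underTerm_eq {t T : Term S} {L U s : List (Term S)} {c : ℕ} (h : Plug t L T)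
    (hs : ∀ t ∈ s, t ≠ Term.leaf) (hL : L ++ U = s ++ List.replicate c Term.leaf) :
    RForest.underTerm t s = T :: nonleaves U := by
  obtain ⟨L', T', h1, h2, h3⟩ := exists_plug_underTerm t s
  have hlen := (h.unique h1).1
  have hLL : L = L' := by
    refine List.ext_getElem hlen fun i hi hi' => ?_
    rw [h3 i hi']
    have : (L ++ U)[i]? = some L[i] := by
      rw [List.getElem?_append_left hi, List.getElem?_eq_getElem hi]
    rw [hL] at this
    rw [List.getD_eq_getElem?_getD]
    by_cases his : i < s.length
    · rw [List.getElem?_append_left his] at this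
      simp [this]
    · rw [List.getElem?_append_right (by omega), List.getElem?_replicate] at this
      rw [List.getElem?_eq_none (by omega)]
      split_ifs at this
      simpa using this.symm
  have hU : U = s.drop L.length ++ List.replicate (c - (L.length - s.length)) Term.leaf := by
    have := congrArg (List.drop L.length) hL
    simpa [List.drop_append] using this
  rw [h2, (h.unique h1).2 hLL, hU, ← hlen, nonleaves_append, nonleaves_replicate, List.append_nil,
    nonleaves_eq_self fun t ht => hs t (List.mem_of_mem_drop ht)]

theorem exists_plug_append_eq (t : Term S) (s : List (Term S)) :
    ∃ L U T c, Plug t L T ∧ L ++ U = s ++ List.replicate c leaf := by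
  obtain ⟨L, T, h1, -, h3⟩ := exists_plug_underTerm t s
  refine ⟨L, s.drop L.length, T, L.length - s.length, h1, ?_⟩
  refine List.ext_getElem (by simp; omega) fun i hi hi' => ?_
  by_cases h : i < L.length
  · rw [List.getElem_append_left h, h3 i h]
    by_cases his : i < s.length
    · rw [List.getElem_append_left his]
      simp [his]
    · rw [List.getElem_append_right (by omega)]
      simp [List.getElem?_eq_none (show s.length ≤ i by omega)]
  · simp only [List.length_append, List.length_drop] at hi
    rw [List.getElem_append_right (by omega), List.getElem_append_left (by omega)]
    simp only [List.getElem_drop]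
    congr 1
    omega

theorem Plug.fLe_underTerm {t T : Term S} {L U : List (Term S)} (h : Plug t L T) :
    FLe (T :: nonleaves U) (RForest.underTerm t (nonleaves (L ++ U))) := by
  obtain ⟨c, hc⟩ := exists_bLe_nonleaves_append (L ++ U)
  obtain ⟨L', U', T', h1, h2, h3⟩ := h.exists_fLe hc
  rwa [h2.underTerm_eq (nonleaves_ne_leaf _) h1.symm]

theorem exists_plug_self (t : Term S) : ∃ k, Plug t (List.replicate k leaf) t := by
  obtain ⟨L, h1, h2⟩ := exists_plug_pre t t.degree
  have h3 := pre_suf_of_degree_le t t.degree le_rfl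
  rw [h3.2] at h2
  rw [h3.1, eq_replicate_of_nonleaves_eq_nil h2.symm] at h1
  exact ⟨_, h1⟩

/-- Starts with every slot of `t` vacant and all terms to the right, then slides them into place. -/
theorem Plug.cons_fLe {t T : Term S} {L U : List (Term S)} (h : Plug t L T)
    (hU : ∀ t ∈ U, t ≠ Term.leaf) : FLe (t :: nonleaves (L ++ U)) (T :: U) := by
  obtain ⟨k, hk⟩ := exists_plug_self t
  -- The padding counts the terms leaving `L`; comparing lengths then shows that the initial leaves
  -- fill exactly the slots of `t`.
  set V := U ++ List.replicate (nonleaves L).length Term.leaf with hV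
  have hnV : nonleaves V = U := by simp [hV, nonleaves_eq_self hU]
  obtain ⟨c, hc⟩ := exists_replicate_append_bLe (L ++ V)
  have hkL : k = L.length := by simpa using (hk.unique h).1
  have hck : c = k := by
    have := BLe.length_eq hc
    simp only [List.length_append, nonleaves_append, List.length_replicate, hnV] at this
    simp only [hV, List.length_append, List.length_replicate] at this
    omega
  subst hck
  obtain ⟨L', U', T', h1, h2, h3⟩ := hk.exists_fLe hc
  obtain ⟨rfl, rfl⟩ := List.append_inj h1 (h.unique h2).1
  rw [(h.unique h2).2 rfl]
  rw [hnV, nonleaves_eq_self (nonleaves_ne_leaf _), nonleaves_append, hnV] at h3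
  rwa [nonleaves_append, nonleaves_eq_self hU]

theorem _root_.ForestStep.underList_right {s s' : List (Term S)} (h : ForestStep s s')
    (hs : ∀ t ∈ s, t ≠ leaf) (f : List (Term S)) :
    FLe (RForest.underList f s) (RForest.underList f s') := by
  rcases List.eq_nil_or_concat' f with rfl | ⟨p, t, rfl⟩
  · exact Relation.ReflTransGen.single h
  obtain ⟨L, U, T, c, h1, h2⟩ := exists_plug_append_eq t s
  obtain ⟨c', hc⟩ := h.exists_bLe hs c
  rw [← h2] at hc
  obtain ⟨L', U', T', h3, h4, h5⟩ := h1.exists_fLe hc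
  rw [underList_concat, underList_concat, h1.underTerm_eq hs h2,
    h4.underTerm_eq (h.ne_leaf hs) h3.symm]
  simpa using FLe.context h5 p []

/-- After lifting the step, a new slot may be vacant in the middle of the word; packing to the left
restores an under. -/
theorem Step.underTerm {t t' : Term S} (h : t.Step t') {s : List (Term S)}
    (hs : ∀ t ∈ s, t ≠ leaf) : FLe (RForest.underTerm t s) (RForest.underTerm t' s) := by
  obtain ⟨L, U, T, c, h1, h2⟩ := exists_plug_append_eq t s
  obtain ⟨L', T', h3, h4, h5⟩ := h1.step h
  have e : nonleaves (L' ++ U) = s := by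
    rw [nonleaves_append, h4, ← nonleaves_append, h2]
    simp [nonleaves_eq_self hs]
  rw [h1.underTerm_eq hs h2]
  refine Relation.ReflTransGen.head (ForestStep.inner [] _ _ _ h5) ?_
  have := h3.fLe_underTerm (U := U)
  rwa [e] at this

theorem _root_.ForestStep.underList_left {f f' s : List (Term S)} (h : ForestStep f f')
    (hf : ∀ t ∈ f, t ≠ leaf) (hs : ∀ t ∈ s, t ≠ leaf) :
    FLe (RForest.underList f s) (RForest.underList f' s) := by
  cases h with
  | root p q x v =>
    rcases List.eq_nil_or_concat' q with rfl | ⟨q, z, rfl⟩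
    -- Here the moved term is the last one: `v` and `x.graftRight v` have the same slots.
    · have e : p ++ [x, v] = (p ++ [x]) ++ [v] := by simp
      rw [e, underList_concat, underList_concat]
      obtain ⟨L, U, T, c, h1, h2⟩ := exists_plug_append_eq v s
      rw [h1.underTerm_eq hs h2, (h1.graftRight_left (hf v (by simp)) x).underTerm_eq hs h2]
      exact Relation.ReflTransGen.single (by simpa using ForestStep.root p (nonleaves U) x T)
    · have e : p ++ x :: v :: (q ++ [z]) = (p ++ x :: v :: q) ++ [z] := by simp
      have e' : p ++ x.graftRight v :: (q ++ [z]) = (p ++ x.graftRight v :: q) ++ [z] := by simp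
      rw [e, e', underList_concat, underList_concat]
      exact Relation.ReflTransGen.single
        (by simpa using ForestStep.root p (q ++ RForest.underTerm z s) x v)
  | inner p q t t' h =>
    rcases List.eq_nil_or_concat' q with rfl | ⟨q, z, rfl⟩
    · rw [underList_concat, underList_concat]
      simpa using FLe.context (h.underTerm hs) p []
    · have e : ∀ t, p ++ t :: (q ++ [z]) = (p ++ t :: q) ++ [z] := by simp
      rw [e, e, underList_concat, underList_concat]
      exact Relation.ReflTransGen.single
        (by simpa using ForestStep.inner p (q ++ RForest.underTerm z s) t t' h)

end Term

/-! ### The cut of reduced forests and its fibres -/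

namespace Term

variable {S : ℕ → Type u} [IsEmpty (S 0)]

theorem suf_ne_leaf (t : Term S) (m : ℕ) : ∀ s ∈ t.suf m, s ≠ leaf := by
  obtain ⟨L, -, h⟩ := exists_plug_pre t m
  rw [h]
  exact nonleaves_ne_leaf L

theorem sufL_ne_leaf (m : ℕ) (L : List (Term S)) : ∀ s ∈ sufL m L, s ≠ leaf := by
  induction L generalizing m with
  | nil => simp [sufL]
  | cons t L ih =>
    intro s hs
    rcases List.mem_append.1 hs with hs | hs
    · exact suf_ne_leaf t m s hs
    · exact ih _ s hs

end Term

namespace RForest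

open Term

variable {S : ℕ → Type u}

/-- The number of internal nodes. -/
def degree (f : RForest S) : ℕ := degreeL f.1

theorem card_content (f : RForest S) : f.content.card = f.degree := by
  obtain ⟨f, hf⟩ := f
  simp only [content, degree, degreeL]
  clear hf
  induction f with
  | nil => rfl
  | cons t f ih => simp [Term.card_content, ih]

variable [IsEmpty (S 0)]

/-- Steps preserve reducedness, so a chain of words starting at a reduced forest stays reduced. -/
theorem le_iff_fLe {f g : RForest S} : f ≤ g ↔ FLe f.1 g.1 := by
  constructor
  · exact fun h => Relation.ReflTransGen.lift Subtype.val (fun _ _ h => h) _ _ h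
  · obtain ⟨g, hg⟩ := g
    intro h
    change FLe f.1 g at h
    induction h with
    | refl => exact le_rfl
    | tail h1 h2 ih =>
      have : ∀ l, FLe f.1 l → ∀ t ∈ l, t ≠ leaf := by
        intro l h
        induction h with
        | refl => exact f.2
        | tail _ h ih => exact h.ne_leaf ih
      exact Relation.ReflTransGen.tail (ih (this _ h1)) h2

/-- The reduced forest formed by the first `m` internal nodes in preorder, and the one formed by the
remaining ones. -/
noncomputable def cut (m : ℕ) (f : RForest S) : RForest S × RForest S :=
  (⟨nonleaves (preL m f.1), nonleaves_ne_leaf _⟩, ⟨sufL m f.1, sufL_ne_leaf m f.1⟩)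

theorem cut_mono (m : ℕ) : Monotone (cut m : RForest S → RForest S × RForest S) := by
  intro f g h
  induction (h : Relation.ReflTransGen Step f g) with
  | refl => exact le_rfl
  | @tail b c h1 h2 ih =>
    refine ih.trans ?_
    have := ForestStep.pre_suf h2 b.2 m
    exact ⟨le_iff_fLe.2 this.1, le_iff_fLe.2 this.2⟩

theorem degree_eq_of_le {f g : RForest S} (h : f ≤ g) : g.degree = f.degree := by
  rw [← card_content, ← card_content, content_eq_of_rtg h]

theorem cut_opOver (f f' : RForest S) : cut f.degree (f.opOver f') = (f, f') := by
  refine Prod.ext (Subtype.ext ?_) (Subtype.ext ?_)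
  · simp [cut, opOver, degree, preL_append, preL_of_degreeL_le, nonleaves_eq_self f.2]
  · simp [cut, opOver, degree, sufL_append, sufL_of_degreeL_le, nonleaves_eq_self f'.2]

theorem cut_opUnder (f f' : RForest S) : cut f.degree (f.opUnder f') = (f, f') := by
  obtain ⟨f, hf⟩ := f
  obtain ⟨s, hs⟩ := f'
  rcases List.eq_nil_or_concat' f with rfl | ⟨p, t, rfl⟩
  · refine Prod.ext (Subtype.ext ?_) (Subtype.ext ?_)
    · simp [cut, degree]
    · simp [cut, degree, opUnder, underList, nonleaves_eq_self hs]
  · obtain ⟨L, U, T, c, h1, h2⟩ := exists_plug_append_eq t s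
    have e := h1.pre_suf
    have e' : t.degree - T.degree = 0 := by
      have := h1.degree_eq
      omega
    have hp : nonleaves (p ++ [t]) = p ++ [t] := nonleaves_eq_self hf
    refine Prod.ext (Subtype.ext ?_) (Subtype.ext ?_)
    · simp only [cut, degree, opUnder, underList_concat, h1.underTerm_eq hs h2]
      rw [preL_append, preL_of_degreeL_le (by simp)]
      simp only [degreeL_append, degreeL_cons, degreeL_nil, add_zero, Nat.add_sub_cancel_left, preL,
        e.1, e', preL_zero]
      rw [← List.singleton_append, ← List.append_assoc, nonleaves_append, nonleaves_replicate,
        List.append_nil, hp]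
    · simp only [cut, degree, opUnder, underList_concat, h1.underTerm_eq hs h2]
      rw [sufL_append, sufL_of_degreeL_le (by simp)]
      simp only [degreeL_append, degreeL_cons, degreeL_nil, add_zero, Nat.add_sub_cancel_left, sufL,
        e.2, e', sufL_zero, List.nil_append]
      rw [nonleaves_eq_self (nonleaves_ne_leaf U), ← nonleaves_append, h2]
      simp [nonleaves_eq_self hs]

/-- Only the term containing the cut matters; for it the bounds are `Plug.cons_fLe` and
`Plug.fLe_underTerm`. -/
theorem mem_Icc_cut (m : ℕ) (f : RForest S) :
    (cut m f).1.opOver (cut m f).2 ≤ f ∧ f ≤ (cut m f).1.opUnder (cut m f).2 := by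
  rw [le_iff_fLe, le_iff_fLe]
  obtain ⟨f, hf⟩ := f
  change FLe (nonleaves (preL m f) ++ sufL m f) f ∧
    FLe f (underList (nonleaves (preL m f)) (sufL m f))
  by_cases hne : f = []
  · subst hne
    exact ⟨Relation.ReflTransGen.refl, Relation.ReflTransGen.refl⟩
  obtain ⟨p, t, T, L, U, rfl, h2, h3, h4, h5⟩ :=
    exists_plug_preL hne (fun T _ => exists_plug_pre T) m
  rw [h2, h5]
  -- If `t` is a leaf then no node is kept, the first half is empty, and both bounds equal the
  -- forest itself.
  by_cases ht : t = leaf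
  · subst ht
    obtain rfl : p = [] := by simpa using h3
    cases h4
    have e : nonleaves ([T] ++ U) = T :: U := nonleaves_eq_self hf
    simp only [List.nil_append, nonleaves_cons_leaf, nonleaves_replicate, e, underList]
    exact ⟨Relation.ReflTransGen.refl, Relation.ReflTransGen.refl⟩
  · have hp : nonleaves p = p := nonleaves_eq_self fun t ht => hf t (by simp [ht])
    have hU' : ∀ t ∈ U, t ≠ leaf := fun t ht => hf t (by simp [ht])
    have hU : nonleaves U = U := nonleaves_eq_self hU'
    have h6 := h4.fLe_underTerm (U := U)
    have h7 := h4.cons_fLe hU'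
    rw [hU] at h6
    rw [nonleaves_append p, nonleaves_cons ht, nonleaves_replicate, hp, underList_concat]
    exact ⟨by simpa using FLe.context h7 p [], by simpa using FLe.context h6 p []⟩

theorem opOver_mono {f f' g g' : RForest S} (h : f ≤ f') (h' : g ≤ g') :
    f.opOver g ≤ f'.opOver g' := by
  rw [le_iff_fLe] at h h' ⊢
  have h1 : FLe (f.1 ++ g.1) (f'.1 ++ g.1) := FLe.context h [] g.1
  have h2 : FLe (f'.1 ++ g.1) (f'.1 ++ g'.1) := by simpa using FLe.context h' f'.1 []
  exact h1.trans h2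

theorem opUnder_mono {f f' g g' : RForest S} (h : f ≤ f') (h' : g ≤ g') :
    f.opUnder g ≤ f'.opUnder g' := by
  have h1 : f.opUnder g ≤ f'.opUnder g := by
    clear h'
    induction (h : Relation.ReflTransGen Step f f') with
    | refl => exact le_rfl
    | @tail b c h1 h2 ih =>
      exact ih.trans (le_iff_fLe.2 (ForestStep.underList_left h2 b.2 g.2))
  have h2 : f'.opUnder g ≤ f'.opUnder g' := by
    clear h h1
    induction (h' : Relation.ReflTransGen Step g g') with
    | refl => exact le_rfl
    | @tail b c h1 h2 ih =>
      exact ih.trans (le_iff_fLe.2 (ForestStep.underList_right h2 b.2 f'.1))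
  exact h1.trans h2

/-- Both ends of the interval have cut `(g, g')`, so monotonicity and antisymmetry force the same
cut in between; the converse is `mem_Icc_cut`. -/
theorem mem_Icc_iff_cut_eq {f g g' : RForest S} {m : ℕ} (hm : g.degree = m) :
    f ∈ Finset.Icc (g.opOver g') (g.opUnder g') ↔ cut m f = (g, g') := by
  subst hm
  rw [Finset.mem_Icc]
  constructor
  · rintro ⟨h1, h2⟩
    have h3 := cut_mono g.degree h1
    have h4 := cut_mono g.degree h2
    rw [cut_opOver] at h3
    rw [cut_opUnder] at h4
    exact le_antisymm h4 h3
  · intro h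
    have := mem_Icc_cut g.degree f
    rwa [h] at this

end RForest

/-! ### Change of basis and the product formulas -/

namespace NatAlgebra

variable (K : Type v) [Field K] {S : ℕ → Type u}

theorem E_mul_E (f f' : RForest S) : E K f * E K f' = E K (f.opOver f') := by
  rw [E, E, MonoidAlgebra.single_mul_single, one_mul]
  rfl

variable [IsEmpty (S 0)]

theorem E_eq_sum_F (f : RForest S) : E K f = ∑ g ∈ Finset.Ici f, F K g := by
  classical
  have h : ∑ g ∈ Finset.Ici f, F K g =
      ∑ h ∈ Finset.Ici f, ∑ g ∈ Finset.Icc f h, IncidenceAlgebra.mu K g h • E K h := by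
    simp only [F]
    refine Finset.sum_comm' fun g h => ?_
    simp only [Finset.mem_Ici, Finset.mem_Icc]
    exact ⟨fun h => ⟨h, h.1.trans h.2⟩, fun h => h.1⟩
  rw [h]
  simp only [← Finset.sum_smul, IncidenceAlgebra.sum_Icc_mu_left]
  rw [Finset.sum_eq_single f]
  · simp
  · intro g _ hg
    simp [Ne.symm hg]
  · simp

/-- Injectivity of summation over up-sets, by induction on the size of the up-set. -/
theorem eq_of_sum_Ici_eq {P M : Type*} [PartialOrder P] [LocallyFiniteOrderTop P]
    [AddCommGroup M] {a b : P → M} (h : ∀ x, ∑ y ∈ Finset.Ici x, a y = ∑ y ∈ Finset.Ici x, b y)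
    (x : P) : a x = b x := by
  classical
  induction hn : (Finset.Ici x).card using Nat.strong_induction_on generalizing x with
  | _ n ih =>
    have hx := h x
    rw [← Finset.Ioi_insert, Finset.sum_insert (by simp), Finset.sum_insert (by simp)] at hx
    have : ∑ y ∈ Finset.Ioi x, a y = ∑ y ∈ Finset.Ioi x, b y := by
      refine Finset.sum_congr rfl fun y hy => ?_
      refine ih _ ?_ y rfl
      rw [← hn]
      exact Finset.card_lt_card (Finset.Ici_ssubset_Ici.2 (Finset.mem_Ioi.1 hy))
    rwa [this, add_left_inj] at hx

open RForest in
-- The intervals are the fibres of `cut f.degree` on the up-set of `f / f'`. One cut index serves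
-- all of them, since degree is constant along the order.
theorem sum_Icc_eq (f f' : RForest S) :
    ∑ g ∈ Finset.Ici f, ∑ g' ∈ Finset.Ici f',
      ∑ h ∈ Finset.Icc (g.opOver g') (g.opUnder g'), F K h = E K (f.opOver f') := by
  classical
  rw [E_eq_sum_F, ← Finset.sum_product', ← Finset.sum_fiberwise_of_maps_to (g := cut f.degree)
    (t := Finset.Ici f ×ˢ Finset.Ici f')]
  · refine Finset.sum_congr rfl fun ⟨g, g'⟩ hg => Finset.sum_congr (Finset.ext fun h => ?_)
      fun _ _ => rfl
    simp only [Finset.mem_product, Finset.mem_Ici] at hg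
    rw [mem_Icc_iff_cut_eq (degree_eq_of_le hg.1), Finset.mem_filter, Finset.mem_Ici]
    refine ⟨fun hh => ⟨?_, hh⟩, fun hh => hh.2⟩
    rw [← mem_Icc_iff_cut_eq (degree_eq_of_le hg.1), Finset.mem_Icc] at hh
    exact (opOver_mono hg.1 hg.2).trans hh.1
  · intro h hh
    have := cut_mono f.degree (Finset.mem_Ici.1 hh)
    rw [cut_opOver] at this
    simpa [Finset.mem_product, Prod.le_def] using this

/-- Summation over up-sets is removed in each argument in turn; the doubly summed identity is the
product rule for `E`. -/
theorem F_mul_F (f f' : RForest S) :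
    F K f * F K f' = ∑ h ∈ Finset.Icc (f.opOver f') (f.opUnder f'), F K h := by
  refine eq_of_sum_Ici_eq (a := fun f => F K f * F K f') (b := fun f =>
    ∑ h ∈ Finset.Icc (f.opOver f') (f.opUnder f'), F K h) (fun g => ?_) f
  refine eq_of_sum_Ici_eq (a := fun f' => ∑ y ∈ Finset.Ici g, F K y * F K f')
    (b := fun f' => ∑ y ∈ Finset.Ici g, ∑ h ∈ Finset.Icc (y.opOver f') (y.opUnder f'), F K h)
    (fun g' => ?_) f'
  rw [Finset.sum_comm, Finset.sum_comm (s := Finset.Ici g'), sum_Icc_eq, ← Finset.sum_mul_sum,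
    ← E_eq_sum_F, ← E_eq_sum_F, E_mul_E]

open RForest in
-- The down-set of `f \ f'` is the disjoint union of the intervals of the pairs below `(f, f')`, by
-- monotonicity of the cut and of the under operation.
theorem H_mul_H (f f' : RForest S) : H K f * H K f' = H K (f.opUnder f') := by
  classical
  rw [H, H, Finset.sum_mul_sum, H, ← Finset.sum_product',
    ← Finset.sum_fiberwise_of_maps_to (s := Finset.Iic (f.opUnder f')) (g := cut f.degree)
      (t := Finset.Iic f ×ˢ Finset.Iic f')]
  · refine Finset.sum_congr rfl fun ⟨g, g'⟩ hg => ?_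
    simp only [Finset.mem_product, Finset.mem_Iic] at hg
    rw [F_mul_F]
    refine Finset.sum_congr (Finset.ext fun h => ?_) fun _ _ => rfl
    rw [mem_Icc_iff_cut_eq (degree_eq_of_le hg.1).symm, Finset.mem_filter, Finset.mem_Iic]
    refine ⟨fun hh => ⟨?_, hh⟩, fun hh => hh.2⟩
    rw [← mem_Icc_iff_cut_eq (degree_eq_of_le hg.1).symm, Finset.mem_Icc] at hh
    exact hh.2.trans (opUnder_mono hg.1 hg.2)
  · intro h hh
    have := cut_mono f.degree (Finset.mem_Iic.1 hh)
    rw [cut_opUnder] at this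
    simpa [Finset.mem_product, Prod.le_def] using this

end NatAlgebra

theorem mainTheorem3 (K : Type v) [Field K] [CharZero K] (S : ℕ → Type u) [IsEmpty (S 0)]
    (f' f'' : RForest S) :
    NatAlgebra.E K f' * NatAlgebra.E K f'' = NatAlgebra.E K (f'.opOver f'') ∧
    NatAlgebra.F K f' * NatAlgebra.F K f'' =
      ∑ f ∈ Finset.Icc (f'.opOver f'') (f'.opUnder f''), NatAlgebra.F K f ∧
    NatAlgebra.H K f' * NatAlgebra.H K f'' = NatAlgebra.H K (f'.opUnder f'') :=
  ⟨NatAlgebra.E_mul_E K f' f'', NatAlgebra.F_mul_F K f' f'', NatAlgebra.H_mul_H K f' f''⟩
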